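/- Let $\mathbb{K}=\mathbb{R}$ or $\mathbb{K}=\mathbb{C}$. Equip $\mathbb{K}[t]$ with the involution $*$ that conjugates all coefficients and fixes $t$ (so it is the identity if $\mathbb{K}=\mathbb{R}$). For a matrix $A$ over $\mathbb{K}[t]$ let $A^*$ be the transpose of $A$ with $*$ applied to each entry, and let $U_n(\mathbb{K}[t])=\{U\in \mathrm{Mat}_n(\mathbb{K}[t]) : U^*U=1\}$. For $N\in \mathrm{Mat}_n(\mathbb{K}[t])$, call $Q_1,Q_2\in\mathrm{Mat}_n(\mathbb{K}[t])$ with $Q_1^*Q_1=Q_2^*Q_2=N$ equivalent $n\times n$-factorizations of $N$ if $Q_2=UQ_1$ for some $U\in U_n(\mathbb{K}[t])$, and let $$\mathcal{F}_n(N)=\{Q\in \mathrm{Mat}_n(\mathbb{K}[t]) : Q^*Q=N\}/U_n(\mathbb{K}[t])$$ be the set of equivalence classes. Theorem. Let $M\in\mathrm{Mat}_n(\mathbb{K}[t])$ be hermitian ($M^*=M$) and positive semidefinite (that is, $M(x)$ is positive semidefinite for every $x\in\mathbb{R}$), with $\det(M)\neq 0$. Let $D$ be the monic Smith normal form of $M$,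 i.e. the unique diagonal matrix $D=\mathrm{diag}(a_1,\dots,a_n)$ with monic $a_i\in\mathbb{K}[t]$ and $a_i\mid a_{i+1}$ for $1\le i<n$ such that $D=SMT$ for some invertible $S,T\in\mathrm{Mat}_n(\mathbb{K}[t])$. Then there is a bijection between $\mathcal{F}_n(M)$ and $\mathcal{F}_n(D)$. -/

import Mathlib

open Polynomial
open scoped Matrix ComplexOrder

namespace HermitianFactorization

/-- The involution on `R[t]`: apply the involution of `R` to all coefficients, so that `t* = t`.
For `R = ℂ` this is coefficientwise complex conjugation, for `R = ℝ` it is the identity. -/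
noncomputable instance polynomialStarRing {R : Type*} [CommRing R] [StarRing R] :
    StarRing R[X] where
  star p := p.map (starRingEnd R)
  star_involutive p := by
    show (p.map (starRingEnd R)).map (starRingEnd R) = p
    ext i
    simp
  star_mul p q := by
    show (p * q).map (starRingEnd R) = q.map (starRingEnd R) * p.map (starRingEnd R)
    rw [Polynomial.map_mul, mul_comm]
  star_add p q := Polynomial.map_add (starRingEnd R)

/-- The involution on polynomials acts coefficientwise. -/
theorem coeff_star {R : Type*} [CommRing R] [StarRing R] (p : R[X]) (i : ℕ) :
    (star p).coeff i = star (p.coeff i) :=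
  Polynomial.coeff_map (starRingEnd R) i

/-- A matrix polynomial `M` is positive semidefinite if the constant matrix `M(x)` is (hermitian)
positive semidefinite for every real number `x`. -/
def IsPosSemidef {𝕂 : Type*} [RCLike 𝕂] {n : ℕ} (M : Matrix (Fin n) (Fin n) 𝕂[X]) : Prop :=
  ∀ x : ℝ, (M.map (fun p : 𝕂[X] => p.eval (x : 𝕂))).PosSemidef

/-- The `k × n`-factorizations `M = Q* Q` of an `n × n`-matrix `M`. -/
def Factorization {R : Type*} [CommRing R] [StarRing R] {n : ℕ}
    (M : Matrix (Fin n) (Fin n) R) (k : ℕ) : Type _ :=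
  {Q : Matrix (Fin k) (Fin n) R // Qᴴ * Q = M}

/-- Two factorizations are equivalent if they lie in the same orbit of the left action of the
unitary group `U_k(R)`. -/
def factorizationSetoid {R : Type*} [CommRing R] [StarRing R] {n : ℕ}
    (M : Matrix (Fin n) (Fin n) R) (k : ℕ) : Setoid (Factorization M k) where
  r Q P := ∃ U ∈ Matrix.unitaryGroup (Fin k) R, U * Q.1 = P.1
  iseqv :=
    { refl := fun Q => ⟨1, one_mem _, Matrix.one_mul _⟩
      symm := by
        rintro Q P ⟨U, hU, h⟩
        refine ⟨star U, Unitary.star_mem hU, ?_⟩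
        rw [← h, ← Matrix.mul_assoc, Matrix.mem_unitaryGroup_iff'.1 hU, Matrix.one_mul]
      trans := by
        rintro Q P S ⟨U, hU, h⟩ ⟨V, hV, h'⟩
        refine ⟨V * U, mul_mem hV hU, ?_⟩
        rw [Matrix.mul_assoc, h, h'] }

/-- The set of equivalence classes of `k × n`-factorizations of `M` over `R`, that is
`{Q ∈ Mat_{k × n}(R) | Q* Q = M} / U_k(R)`. -/
def Fac {R : Type*} [CommRing R] [StarRing R] {n : ℕ}
    (M : Matrix (Fin n) (Fin n) R) (k : ℕ) : Type _ :=
  Quotient (factorizationSetoid M k)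

/-- `D` is the monic Smith normal form of `M` over `F[t]`: it is a diagonal matrix
`⟨a₁, …, a_n⟩ = S M T` with `S`, `T` invertible, `aᵢ ∣ aⱼ` for `i ≤ j`, and every nonzero `aᵢ`
monic. (By divisibility the zero entries, if any, come last.) -/
def IsMonicSmithNormalForm {F : Type*} [Field F] {n : ℕ}
    (M D : Matrix (Fin n) (Fin n) F[X]) : Prop :=
  ∃ a : Fin n → F[X],
    D = Matrix.diagonal a ∧
    (∀ i j : Fin n, i ≤ j → a i ∣ a j) ∧
    (∀ i, a i ≠ 0 → (a i).Monic) ∧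
    ∃ S T : Matrix (Fin n) (Fin n) F[X], IsUnit S ∧ IsUnit T ∧ S * M * T = D

end HermitianFactorization

/-!
Factorizations of `M` are counted by local data, and locally `M` and its Smith normal form `D`
are isometric.

*Lattices.* A factorization `M = Qᴴ * Q` is determined up to a unitary matrix by the column lattice
of `Qᴴ`. This lattice is self-dual for the form `v* M⁻¹ w` modulo `𝕂[t]`, written here without
denominators as `v* adj(M) w` modulo `det M`. Conversely, a self-dual lattice yields
`M = Zᴴ * H * Z` with `H` positive semidefinite of constant determinant, and such an `H` is
`Uᴴ * U`: otherwise the singular matrix of leading coefficients allows one to lower the degrees of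
the diagonal by a congruence (`exists_conjTranspose_mul_self_of_isUnit_det`). So `Fac M n` is the
set of self-dual lattices of `M` (`facEquivSelfDual`), and likewise for `D`.

*Isometry modulo `det D`.* Let `S * M * T = D`. Replacing `M` by the congruent matrix `Tᴴ * M * T`
gives `M = P * D` with `P = Tᴴ * S⁻¹` invertible. Both `M` and `D` are Hermitian, so
`P * D = D * Pᴴ`, and this relation passes to all real polynomials in `P`. If such a polynomial `X`
satisfies `X ^ 2 ≡ P` modulo `det D`, then `M ≡ X * D * Xᴴ`, and `X` identifies the self-dual
lattices of `M` and `D` (`nonempty_selfDual_equiv`). The matrix `X` is a square root of `z` in the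
finite-dimensional real algebra `ℝ[t][z] / (det D, charpoly P)`. It exists because at every real
character the value of `z` is an eigenvalue of some `P(x)`, and these are never negative or zero
(`exists_sq_eq_add_smul`, `eval_charpoly_ne_zero`): where `D(x)` is positive definite, `P(x)` is
similar to a positive semidefinite matrix with fixed nonzero determinant, and at the remaining
points one passes to the limit.

*Positivity of `D`.* The entries of `D` are real by the uniqueness of the Smith normal form
(`star_eq_of_smith`). A real zero of odd multiplicity of one of them would produce a block of zeros
in `P(x)` so large that `P(x)` is singular (`even_rootMultiplicity_of_isPosSemidef`), so all
multiplicities are even and the entries are nonnegative on the real line.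
-/

namespace HermitianFactorization

/-! ### Evaluation of matrix polynomials at real points -/

section Eval

variable {𝕂 : Type*} [RCLike 𝕂]

theorem eval_star (p : 𝕂[X]) (x : ℝ) :
    (star p).eval (x : 𝕂) = star (p.eval (x : 𝕂)) := by
  have h : (star p) = p.map (starRingEnd 𝕂) := rfl
  have hx : (x : 𝕂) = starRingEnd 𝕂 (x : 𝕂) := (RCLike.conj_ofReal x).symm
  rw [h, hx, Polynomial.eval_map_apply, ← hx]
  rfl

theorem star_map_ofReal (q : ℝ[X]) :
    star (q.map (algebraMap ℝ 𝕂)) = q.map (algebraMap ℝ 𝕂) := by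
  ext i
  rw [coeff_star, coeff_map]
  exact RCLike.conj_ofReal _

theorem exists_real_of_star_eq {p : 𝕂[X]} (h : star p = p) :
    ∃ q : ℝ[X], q.map (algebraMap ℝ 𝕂) = p := by
  rw [← Polynomial.mem_lifts, Polynomial.lifts_iff_coeff_lifts]
  intro i
  have hi : starRingEnd 𝕂 (p.coeff i) = p.coeff i := by
    conv_rhs => rw [← h]
    rw [coeff_star]; rfl
  obtain ⟨r, hr⟩ := RCLike.conj_eq_iff_real.1 hi
  exact ⟨r, hr.symm⟩

theorem eval_map_ofReal (q : ℝ[X]) (x : ℝ) :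
    (q.map (algebraMap ℝ 𝕂)).eval (x : 𝕂) = ((q.eval x : ℝ) : 𝕂) :=
  Polynomial.eval_map_apply (algebraMap ℝ 𝕂) x

/-- The value `M(x)` of a matrix polynomial at a real point, as a ring homomorphism. -/
noncomputable def evalMatrix {n : ℕ} (x : ℝ) :
    Matrix (Fin n) (Fin n) 𝕂[X] →+* Matrix (Fin n) (Fin n) 𝕂 :=
  (evalRingHom (x : 𝕂)).mapMatrix

variable {n : ℕ}

@[simp]
theorem evalMatrix_apply (x : ℝ) (M : Matrix (Fin n) (Fin n) 𝕂[X]) (i j : Fin n) :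
    evalMatrix x M i j = (M i j).eval (x : 𝕂) := rfl

theorem evalMatrix_conjTranspose (x : ℝ) (M : Matrix (Fin n) (Fin n) 𝕂[X]) :
    evalMatrix x Mᴴ = (evalMatrix x M)ᴴ := by
  ext i j
  exact eval_star (M j i) x

theorem det_evalMatrix (x : ℝ) (M : Matrix (Fin n) (Fin n) 𝕂[X]) :
    (evalMatrix x M).det = M.det.eval (x : 𝕂) :=
  ((evalRingHom (x : 𝕂)).map_det M).symm

theorem isPosSemidef_iff {M : Matrix (Fin n) (Fin n) 𝕂[X]} :
    IsPosSemidef M ↔ ∀ x : ℝ, (evalMatrix x M).PosSemidef := Iff.rfl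

theorem IsPosSemidef.conjTranspose_mul_mul_same {M : Matrix (Fin n) (Fin n) 𝕂[X]}
    (hM : IsPosSemidef M) (T : Matrix (Fin n) (Fin n) 𝕂[X]) : IsPosSemidef (Tᴴ * M * T) := by
  rw [isPosSemidef_iff] at *
  intro x
  rw [map_mul, map_mul, evalMatrix_conjTranspose]
  exact (hM x).conjTranspose_mul_mul_same _

theorem continuous_eval_ofReal (p : 𝕂[X]) : Continuous fun x : ℝ => p.eval (x : 𝕂) :=
  p.continuous.comp RCLike.continuous_ofReal

theorem continuous_evalMatrix (M : Matrix (Fin n) (Fin n) 𝕂[X]) :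
    Continuous fun x : ℝ => evalMatrix x M :=
  continuous_matrix fun i j => continuous_eval_ofReal (M i j)

/-- A closed condition on a real number that holds off the zeros of a nonzero polynomial holds
everywhere, since the zeros are isolated. -/
theorem forall_mem_of_isClosed {g : 𝕂[X]} (hg : g ≠ 0) {s : Set ℝ} (hs : IsClosed s)
    (h : ∀ x : ℝ, g.eval (x : 𝕂) ≠ 0 → x ∈ s) (x : ℝ) : x ∈ s := by
  have hfin : {x : ℝ | g.eval (x : 𝕂) = 0}.Finite := by
    have h1 : {z : 𝕂 | g.IsRoot z}.Finite := finite_setOfPred_isRoot hg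
    exact h1.preimage (RCLike.ofReal_injective.injOn)
  have hd : Dense {x : ℝ | g.eval (x : 𝕂) = 0}ᶜ := hfin.countable.dense_compl ℝ
  have : closure {x : ℝ | g.eval (x : 𝕂) = 0}ᶜ ⊆ s := hs.closure_subset_iff.2 fun y hy => h y hy
  exact this (by rw [hd.closure_eq]; trivial)

theorem isClosed_setOf_posSemidef : IsClosed {A : Matrix (Fin n) (Fin n) 𝕂 | A.PosSemidef} := by
  have : {A : Matrix (Fin n) (Fin n) 𝕂 | A.PosSemidef} =
      {A | Aᴴ = A} ∩ ⋂ v : Fin n → 𝕂, {A | 0 ≤ star v ⬝ᵥ (A *ᵥ v)} := by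
    ext A
    simp only [Set.mem_ofPred_eq, Set.mem_inter_iff, Set.mem_iInter,
      Matrix.posSemidef_iff_dotProduct_mulVec]
    rfl
  rw [this]
  refine IsClosed.inter (isClosed_eq (by fun_prop) (by fun_prop))
    (isClosed_iInter fun v => isClosed_le (by fun_prop) (by fun_prop))

theorem norm_sq_apply_le {A : Matrix (Fin n) (Fin n) 𝕂} (hA : A.PosSemidef) (i j : Fin n) :
    ‖A i j‖ ^ 2 ≤ RCLike.re (A i i) * RCLike.re (A j j) := by
  have h := (hA.submatrix ![i, j]).det_nonneg
  rw [Matrix.det_fin_two] at h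
  simp only [Matrix.submatrix_apply, Matrix.cons_val_zero, Matrix.cons_val_one] at h
  have hji : A j i = starRingEnd 𝕂 (A i j) := (hA.1.apply j i).symm
  have hi : A i i = (RCLike.re (A i i) : 𝕂) := (RCLike.conj_eq_iff_re.1 (hA.1.apply i i)).symm
  have hj : A j j = (RCLike.re (A j j) : 𝕂) := (RCLike.conj_eq_iff_re.1 (hA.1.apply j j)).symm
  rw [hji, RCLike.mul_conj, hi, hj] at h
  norm_cast at h
  linarith

theorem re_diag_nonneg {A : Matrix (Fin n) (Fin n) 𝕂} (hA : A.PosSemidef) (i : Fin n) :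
    0 ≤ RCLike.re (A i i) :=
  (RCLike.nonneg_iff.1 hA.diag_nonneg).1

end Eval

/-! ### Nonnegative real polynomials -/

theorem leadingCoeff_nonneg_of_eval_nonneg {p : ℝ[X]} (h : ∀ x, 0 ≤ p.eval x) :
    0 ≤ p.leadingCoeff := by
  by_contra! hlt
  by_cases hd : 0 < p.degree
  · have := p.tendsto_atBot_of_leadingCoeff_nonpos hd hlt.le
    obtain ⟨x, hx⟩ := (this.eventually_lt_atBot 0).exists
    exact absurd (h x) (not_le.2 hx)
  · rw [eq_C_of_degree_le_zero (not_lt.1 hd)] at h hlt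
    simp only [leadingCoeff_C, eval_C] at h hlt
    exact absurd (h 0) (not_le.2 hlt)

theorem even_natDegree_of_eval_nonneg {p : ℝ[X]} (h : ∀ x, 0 ≤ p.eval x) :
    Even p.natDegree := by
  by_cases hp : p = 0
  · simp [hp]
  have h1 := leadingCoeff_nonneg_of_eval_nonneg h
  have h2 : 0 ≤ (p.comp (-X)).leadingCoeff :=
    leadingCoeff_nonneg_of_eval_nonneg fun x => by simpa using h (-x)
  have h3 : 0 < p.leadingCoeff := lt_of_le_of_ne h1 (Ne.symm (leadingCoeff_ne_zero.2 hp))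
  by_contra hodd
  rw [Nat.not_even_iff_odd] at hodd
  rw [leadingCoeff_comp (by simp)] at h2
  simp [hodd.neg_one_pow] at h2
  linarith

theorem natDegree_le_of_eval_le {q r : ℝ[X]} (h0 : ∀ x, 0 ≤ q.eval x)
    (h : ∀ x, q.eval x ≤ r.eval x) : q.natDegree ≤ r.natDegree := by
  by_contra! hlt
  have hq : q ≠ 0 := by rintro rfl; simp at hlt
  have h1 : 0 < q.leadingCoeff :=
    lt_of_le_of_ne (leadingCoeff_nonneg_of_eval_nonneg h0) (Ne.symm (leadingCoeff_ne_zero.2 hq))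
  have h2 : 0 ≤ (r - q).leadingCoeff :=
    leadingCoeff_nonneg_of_eval_nonneg fun x => by simpa using h x
  rw [leadingCoeff_sub_of_degree_lt' (degree_lt_degree hlt)] at h2
  linarith

/-- A monic real polynomial all of whose real zeros have even multiplicity is nonnegative on the
real line: divide by squares of linear factors until no real zero is left. -/
theorem eval_nonneg_of_even_rootMultiplicity (q : ℝ[X]) (hq : q.Monic)
    (h : ∀ x, Even (q.rootMultiplicity x)) (x : ℝ) : 0 ≤ q.eval x := by
  induction hd : q.natDegree using Nat.strong_induction_on generalizing q with
  | _ d ih =>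
  by_cases hr : ∃ r, q.IsRoot r
  · obtain ⟨r, hr⟩ := hr
    have hpos : 0 < q.rootMultiplicity r := (rootMultiplicity_pos hq.ne_zero).2 hr
    have h2 : 2 ≤ q.rootMultiplicity r := by
      obtain ⟨m, hm⟩ := h r
      omega
    obtain ⟨q₁, hq₁⟩ := (le_rootMultiplicity_iff hq.ne_zero).1 h2
    have hmon : ((X - C r) ^ 2).Monic := (monic_X_sub_C r).pow 2
    have hmon₁ : q₁.Monic := hmon.of_mul_monic_left (hq₁ ▸ hq)
    have key : 0 ≤ q₁.eval x := by
      refine ih q₁.natDegree ?_ q₁ hmon₁ (fun y => ?_) rfl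
      · rw [← hd, hq₁, hmon.natDegree_mul hmon₁, natDegree_pow, natDegree_X_sub_C]
        omega
      · have := h y
        rw [hq₁, rootMultiplicity_mul (hq₁ ▸ hq.ne_zero)] at this
        refine (Nat.even_add.1 this).1 ?_
        rw [pow_two, rootMultiplicity_mul (mul_self_ne_zero.2 (X_sub_C_ne_zero r))]
        exact ⟨_, rfl⟩
    rw [hq₁, eval_mul, eval_pow]
    positivity
  · push Not at hr
    by_contra! hlt
    have hdeg : 0 < q.degree := by
      by_contra! h0
      rw [hq.degree_le_zero_iff_eq_one.1 h0] at hlt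
      simp at hlt
      linarith
    have ht := q.tendsto_atTop_of_leadingCoeff_nonneg hdeg (by rw [hq.leadingCoeff]; norm_num)
    obtain ⟨y, hy⟩ := (ht.eventually_gt_atTop 0).exists
    obtain ⟨z, -, hz⟩ := intermediate_value_uIcc (a := x) (b := y) (q.continuous.continuousOn)
      (Set.mem_uIcc.2 (Or.inl ⟨hlt.le, hy.le⟩))
    exact hr z hz

/-! ### Determinants with a large zero block and uniqueness of the Smith normal form -/

/-- A divisor `p` of all entries in the block of rows `≥ k` and columns `≤ k` divides the
determinant: this block has `n + 1` rows and columns in total, so every permutation meets it. -/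
theorem dvd_det_of_block {R : Type*} [CommRing R] {n : ℕ} {p : R} {V : Matrix (Fin n) (Fin n) R}
    (k : Fin n) (h : ∀ i j, k ≤ i → j ≤ k → p ∣ V i j) : p ∣ V.det := by
  rw [Matrix.det_apply]
  refine Finset.dvd_sum fun σ _ => ?_
  have : ∃ j, j ≤ k ∧ k ≤ σ j := by
    by_contra! hcon
    have hsub : (Finset.Iic k).map σ.toEmbedding ⊆ Finset.Iio k := by
      intro i hi
      obtain ⟨j, hj, rfl⟩ := Finset.mem_map.1 hi
      exact Finset.mem_Iio.2 (hcon j (Finset.mem_Iic.1 hj))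
    have := Finset.card_le_card hsub
    rw [Finset.card_map, Fin.card_Iic, Fin.card_Iio] at this
    omega
  obtain ⟨j, hj, hk⟩ := this
  rw [Units.smul_def, zsmul_eq_mul]
  exact ((h _ _ hk hj).trans (Finset.dvd_prod_of_mem (fun i => V (σ i) i)
    (Finset.mem_univ j))).mul_left _

/-- One half of the uniqueness of the Smith normal form: an equivalence between diagonal matrices
whose entries form divisibility chains forces divisibility of the entries. -/
theorem diagonal_dvd_of_equiv {F : Type*} [Field F] {n : ℕ} {a b : Fin n → F[X]}
    (ha : ∀ i j, i ≤ j → a i ∣ a j) (hb : ∀ i j, i ≤ j → b i ∣ b j) (hb0 : ∀ i, b i ≠ 0)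
    {U V : Matrix (Fin n) (Fin n) F[X]} (hV : IsUnit V.det)
    (h : Matrix.diagonal a * U = V * Matrix.diagonal b) (k : Fin n) : a k ∣ b k := by
  classical
  -- the cofactor `e = a k / gcd (a k) (b k)` divides the block of `V` at `k`, so it is a unit
  set g := EuclideanDomain.gcd (a k) (b k) with hg
  obtain ⟨e, he⟩ : g ∣ a k := EuclideanDomain.gcd_dvd_left _ _
  obtain ⟨c, hc⟩ : g ∣ b k := EuclideanDomain.gcd_dvd_right _ _
  have hg0 : g ≠ 0 := by rintro h0; exact hb0 k (by rw [hc, h0, zero_mul])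
  have hcop : IsCoprime e c := by
    obtain ⟨x, y, hxy⟩ : ∃ x y, g = a k * x + b k * y := ⟨_, _, EuclideanDomain.gcd_eq_gcd_ab _ _⟩
    refine ⟨x, y, mul_left_cancel₀ hg0 ?_⟩
    calc g * (x * e + y * c) = (g * e) * x + (g * c) * y := by ring
      _ = g * 1 := by rw [← he, ← hc, ← hxy, mul_one]
  have hdvd : e ∣ V.det := by
    refine dvd_det_of_block k fun i j hi hj => hcop.dvd_of_dvd_mul_right ?_
    have hij := congrFun (congrFun h i) j
    rw [Matrix.diagonal_mul, Matrix.mul_diagonal] at hij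
    have h1 : a k ∣ V i j * b k := by
      refine ((ha k i hi).trans ⟨U i j, hij.symm⟩).trans (mul_dvd_mul_left _ (hb j k hj))
    refine (mul_dvd_mul_iff_left hg0).1 ?_
    rw [← he]
    refine h1.trans (dvd_of_eq ?_)
    rw [hc]; ring
  rw [he, hc]
  exact mul_dvd_mul_left _ (isUnit_of_dvd_unit hdvd hV).dvd

/-! ### Parity of the elementary divisors -/

theorem eq_zero_of_odd_pow_mul_nonneg {g : ℝ → ℝ} (hg : Continuous g) {x : ℝ} {m : ℕ}
    (hm : Odd m) (h : ∀ t, 0 ≤ (t - x) ^ m * g t) : g x = 0 := by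
  apply le_antisymm
  · have hmem : x ∈ closure (Set.Iio x) := by rw [closure_Iio]; exact Set.self_mem_Iic
    refine closure_minimal (s := Set.Iio x) (t := {t | g t ≤ 0}) (fun t ht => ?_)
      (isClosed_le hg continuous_const) hmem
    exact nonpos_of_mul_nonneg_right (h t) (hm.pow_neg (sub_neg.2 ht))
  · have hmem : x ∈ closure (Set.Ioi x) := by rw [closure_Ioi]; exact Set.self_mem_Ici
    refine closure_minimal (s := Set.Ioi x) (t := {t | 0 ≤ g t}) (fun t ht => ?_)
      (isClosed_le continuous_const hg) hmem
    exact nonneg_of_mul_nonneg_right (h t) (pow_pos (sub_pos.2 ht) m)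

section Parity

variable {𝕂 : Type*} [RCLike 𝕂] {n : ℕ}

/-- If `P * diagonal a` is positive semidefinite with `P` invertible and `a` a divisibility chain
of real polynomials, then each `a k` has even multiplicity at each real point `x`. For odd
multiplicity `m`, dividing the rows and columns where `a` has multiplicity `m` by the
sign-changing `(t - x) ^ m` shows that `P(x)` vanishes there, and hence on the whole block of rows
`≥ k` and columns `≤ k`; this makes `P(x)` singular. -/
theorem even_rootMultiplicity_of_isPosSemidef {P : Matrix (Fin n) (Fin n) 𝕂[X]}
    {a : Fin n → ℝ[X]} (ha0 : ∀ i, a i ≠ 0) (ha : ∀ i j, i ≤ j → a i ∣ a j)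
    (hP : IsUnit P.det)
    (hH : (P * Matrix.diagonal fun i => (a i).map (algebraMap ℝ 𝕂)).IsHermitian)
    (hpos : IsPosSemidef (P * Matrix.diagonal fun i => (a i).map (algebraMap ℝ 𝕂)))
    (k : Fin n) (x : ℝ) : Even ((a k).rootMultiplicity x) := by
  by_contra hodd
  rw [Nat.not_even_iff_odd] at hodd
  choose b hb hbx using fun i => exists_eq_pow_rootMultiplicity_mul_and_not_dvd (a i) (ha0 i) x
  have hb0 : ∀ i, ((b i).map (algebraMap ℝ 𝕂)).eval (x : 𝕂) ≠ 0 := fun i => by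
    rw [eval_map_ofReal]
    exact_mod_cast fun h => hbx i (dvd_iff_isRoot.2 h)
  have hdvd : (X - C (x : 𝕂)) ∣ P.det := by
    refine dvd_det_of_block k fun i j hi hj => ?_
    rw [dvd_iff_isRoot, IsRoot]
    have hjk := rootMultiplicity_le_rootMultiplicity_of_dvd (ha0 k) (ha j k hj) x
    have hki := rootMultiplicity_le_rootMultiplicity_of_dvd (ha0 i) (ha k i hi) x
    rcases (hjk.trans hki).lt_or_eq with hlt | heq
    -- here `P i j` is a multiple of `t - x` by the Hermitian symmetry `P i j * a j = a i * (P j i)*`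
    · have h1 := hH.apply i j
      rw [Matrix.mul_diagonal, Matrix.mul_diagonal, star_mul', star_map_ofReal, hb i, hb j] at h1
      obtain ⟨r, hr⟩ := Nat.exists_eq_add_of_lt hlt
      rw [hr] at h1
      simp only [Polynomial.map_mul, Polynomial.map_pow, Polynomial.map_sub, map_X, map_C] at h1
      have hX : (X - C (algebraMap ℝ 𝕂 x)) ≠ 0 := X_sub_C_ne_zero _
      have h2 : P i j * (b j).map (algebraMap ℝ 𝕂) =
          (X - C (algebraMap ℝ 𝕂 x)) * ((X - C (algebraMap ℝ 𝕂 x)) ^ r * star (P j i) *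
            (b i).map (algebraMap ℝ 𝕂)) := by
        refine mul_left_cancel₀ (pow_ne_zero ((a j).rootMultiplicity x) hX) ?_
        linear_combination -h1
      have h3 := congrArg (eval (x : 𝕂)) h2
      rw [eval_mul, eval_mul, eval_sub, eval_X, eval_C] at h3
      have hxx : (algebraMap ℝ 𝕂 x) = (x : 𝕂) := rfl
      rw [hxx, sub_self, zero_mul] at h3
      exact (mul_eq_zero.1 h3).resolve_right (hb0 j)
    · set m := (a k).rootMultiplicity x with hm
      have hmj : (a j).rootMultiplicity x = m := by omega
      have hmi : (a i).rootMultiplicity x = m := by omega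
      -- the entries of `P * diagonal a` after division by `(t - x) ^ m`
      let N : Fin n → Fin n → ℝ → 𝕂 := fun p q t =>
        (P p q * (b q).map (algebraMap ℝ 𝕂)).eval (t : 𝕂)
      have hNc : ∀ p q, Continuous (N p q) := fun p q => continuous_eval_ofReal _
      have hN : ∀ p q, (a q).rootMultiplicity x = m → ∀ t : ℝ,
          evalMatrix t (P * Matrix.diagonal fun i => (a i).map (algebraMap ℝ 𝕂)) p q =
            (((t - x) ^ m : ℝ) : 𝕂) * N p q t := by
        intro p q hq t
        rw [evalMatrix_apply, Matrix.mul_diagonal, hb q, hq]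
        simp only [N, Polynomial.map_mul, Polynomial.map_pow, Polynomial.map_sub, map_X, map_C,
          eval_mul, eval_pow, eval_sub, eval_X, eval_C]
        push_cast
        have hxx : (algebraMap ℝ 𝕂 x) = (x : 𝕂) := rfl
        rw [hxx]
        ring
      have hdiag : ∀ p, (a p).rootMultiplicity x = m → RCLike.re (N p p x) = 0 := by
        intro p hp
        refine eq_zero_of_odd_pow_mul_nonneg (g := fun t => RCLike.re (N p p t))
          (RCLike.continuous_re.comp (hNc p p)) hodd fun t => ?_
        have := re_diag_nonneg (hpos t) p
        rwa [← RCLike.re_ofReal_mul, ← hN p p hp t]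
      have hle : x ∈ {t | ‖N i j t‖ ^ 2 ≤ RCLike.re (N i i t) * RCLike.re (N j j t)} := by
        refine forall_mem_of_isClosed (𝕂 := ℝ) (X_sub_C_ne_zero x) (isClosed_le
          ((hNc i j).norm.pow 2) ((RCLike.continuous_re.comp (hNc i i)).mul
            (RCLike.continuous_re.comp (hNc j j)))) (fun t ht => ?_) x
        have htx : t - x ≠ 0 := by simpa using ht
        have h1 := norm_sq_apply_le (hpos t) i j
        change ‖evalMatrix t _ i j‖ ^ 2 ≤ RCLike.re (evalMatrix t _ i i) *
          RCLike.re (evalMatrix t _ j j) at h1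
        rw [hN i j hmj, hN i i hmi, hN j j hmj, norm_mul, RCLike.re_ofReal_mul,
          RCLike.re_ofReal_mul, RCLike.norm_ofReal, mul_pow, sq_abs] at h1
        have h2 : 0 < ((t - x) ^ m) ^ 2 := by positivity
        refine le_of_mul_le_mul_left (h1.trans_eq ?_) h2
        simp only [Pi.mul_apply, Function.comp_apply]
        ring
      have h0 : N i j x = 0 := by
        have h4 : ‖N i j x‖ ^ 2 ≤ RCLike.re (N i i x) * RCLike.re (N j j x) := hle
        rw [hdiag i hmi, zero_mul] at h4
        exact norm_eq_zero.1 (pow_eq_zero_iff two_ne_zero |>.1 (le_antisymm h4 (by positivity)))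
      have h5 : (P i j).eval (x : 𝕂) * ((b j).map (algebraMap ℝ 𝕂)).eval (x : 𝕂) = 0 := by
        rw [← eval_mul]; exact h0
      exact (mul_eq_zero.1 h5).resolve_right (hb0 j)
  exact (irreducible_X_sub_C (x : 𝕂)).not_isUnit (isUnit_of_dvd_unit hdvd hP)

end Parity

/-! ### Positive semidefinite matrices with constant determinant -/

theorem coeff_prod_of_natDegree_le_sum {R ι : Type*} [CommRing R] (s : Finset ι) (f : ι → R[X])
    (d : ι → ℕ) (h : ∀ i ∈ s, (f i).natDegree ≤ d i) :
    (∏ i ∈ s, f i).coeff (∑ i ∈ s, d i) = ∏ i ∈ s, (f i).coeff (d i) := by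
  classical
  induction s using Finset.induction_on with
  | empty => simp
  | insert i s hi ih =>
    rw [Finset.prod_insert hi, Finset.sum_insert hi, Finset.prod_insert hi,
      coeff_mul_add_eq_of_natDegree_le (h i (Finset.mem_insert_self i s)), ih]
    · exact fun j hj => h j (Finset.mem_insert_of_mem hj)
    · exact (natDegree_prod_le s f).trans
        (Finset.sum_le_sum fun j hj => h j (Finset.mem_insert_of_mem hj))

/-- If the entries of `A` have degrees at most `r i + c j`, then the determinant of the matrix of
coefficients in these degrees is the coefficient of `A.det` in degree `∑ r + ∑ c`. -/
theorem coeff_det_of_natDegree_le {R : Type*} [CommRing R] {n : ℕ}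
    (A : Matrix (Fin n) (Fin n) R[X]) (r c : Fin n → ℕ)
    (h : ∀ i j, (A i j).natDegree ≤ r i + c j) :
    A.det.coeff (∑ i, r i + ∑ i, c i) =
      (Matrix.of fun i j => (A i j).coeff (r i + c j)).det := by
  rw [Matrix.det_apply, Matrix.det_apply, finsetSum_coeff]
  refine Finset.sum_congr rfl fun σ _ => ?_
  have hs : ∑ i, r i + ∑ i, c i = ∑ i, (r (σ i) + c i) := by
    rw [Finset.sum_add_distrib, Equiv.sum_comp σ r]
  rw [Units.smul_def, Units.smul_def, coeff_smul, hs,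
    coeff_prod_of_natDegree_le_sum _ _ _ fun i _ => h (σ i) i]
  rfl

section Unimodular

variable {𝕂 : Type*} [RCLike 𝕂] {n : ℕ}

theorem star_C_mul_X_pow (z : 𝕂) (m : ℕ) : star (C z * X ^ m : 𝕂[X]) = C (star z) * X ^ m := by
  have : star (C z * X ^ m : 𝕂[X]) = (C z * X ^ m : 𝕂[X]).map (starRingEnd 𝕂) := rfl
  rw [this]
  simp

theorem eq_zero_of_eval_ofReal {p : 𝕂[X]} (h : ∀ x : ℝ, p.eval (x : 𝕂) = 0) : p = 0 := by
  by_contra hp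
  have h1 : {z : 𝕂 | p.IsRoot z}.Finite := finite_setOfPred_isRoot hp
  have h2 : (Set.univ : Set ℝ).Finite :=
    (h1.preimage (f := fun x : ℝ => (x : 𝕂)) RCLike.ofReal_injective.injOn).subset fun x _ => h x
  exact Set.infinite_univ h2

/-- The diagonal entries of a positive semidefinite matrix polynomial have even degree, and by
the Cauchy–Schwarz inequality half these degrees bound the degrees of all entries. -/
theorem exists_natDegree_le {G : Matrix (Fin n) (Fin n) 𝕂[X]} (hG : G.IsHermitian)
    (hpos : IsPosSemidef G) :
    ∃ m : Fin n → ℕ, (∀ i, (G i i).natDegree = 2 * m i) ∧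
      ∀ i j, (G i j).natDegree ≤ m i + m j := by
  choose q hq using fun i => exists_real_of_star_eq (hG.apply i i)
  have hqre : ∀ i (x : ℝ), RCLike.re (evalMatrix x G i i) = (q i).eval x := fun i x => by
    rw [evalMatrix_apply, ← hq i, eval_map_ofReal, RCLike.ofReal_re]
  have hq0 : ∀ i x, 0 ≤ (q i).eval x := fun i x => by
    rw [← hqre]; exact re_diag_nonneg (hpos x) i
  have hqdeg : ∀ i, (q i).natDegree = (G i i).natDegree := fun i => by
    rw [← hq i, natDegree_map]
  choose m hm using fun i => even_natDegree_of_eval_nonneg (hq0 i)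
  refine ⟨m, fun i => by rw [← hqdeg, hm i, two_mul], fun i j => ?_⟩
  obtain ⟨s, hs⟩ : ∃ s : ℝ[X], s.map (algebraMap ℝ 𝕂) = star (G i j) * G i j :=
    exists_real_of_star_eq (by rw [star_mul', star_star, mul_comm])
  have hse : ∀ x : ℝ, s.eval x = ‖evalMatrix x G i j‖ ^ 2 := fun x => by
    have h1 : ((s.eval x : ℝ) : 𝕂) = ((‖evalMatrix x G i j‖ ^ 2 : ℝ) : 𝕂) := by
      rw [← eval_map_ofReal, hs, eval_mul, eval_star, evalMatrix_apply]
      exact (RCLike.conj_mul _).trans (by push_cast; rfl)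
    exact_mod_cast h1
  have hle : s.natDegree ≤ (q i * q j).natDegree := by
    refine natDegree_le_of_eval_le (fun x => by rw [hse]; positivity) fun x => ?_
    rw [hse, eval_mul, ← hqre, ← hqre]
    exact norm_sq_apply_le (hpos x) i j
  have hsd : s.natDegree = 2 * (G i j).natDegree := by
    have h1 : (star (G i j)).natDegree = (G i j).natDegree := natDegree_map (starRingEnd 𝕂)
    rw [← natDegree_map (algebraMap ℝ 𝕂), hs]
    by_cases h0 : G i j = 0
    · simp [h0]
    · rw [natDegree_mul (star_ne_zero.2 h0) h0, h1, two_mul]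
  have := hle.trans natDegree_mul_le
  rw [hsd, hm, hm] at this
  omega

theorem diag_ne_zero_of_isPosSemidef {G : Matrix (Fin n) (Fin n) 𝕂[X]}
    (hpos : IsPosSemidef G) (hdet : G.det ≠ 0) (i : Fin n) : G i i ≠ 0 := by
  intro h0
  refine hdet (Matrix.det_eq_zero_of_row_eq_zero i fun j => eq_zero_of_eval_ofReal fun x => ?_)
  have h := norm_sq_apply_le (hpos x) i j
  change ‖(G i j).eval (x : 𝕂)‖ ^ 2 ≤ RCLike.re ((G i i).eval (x : 𝕂)) * _ at h
  rw [h0, eval_zero, map_zero, zero_mul] at h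
  exact norm_eq_zero.1 (pow_eq_zero_iff two_ne_zero |>.1 (le_antisymm h (by positivity)))

theorem exists_conjTranspose_mul_self_of_posSemidef {A : Matrix (Fin n) (Fin n) 𝕂}
    (hA : A.PosSemidef) : ∃ V : Matrix (Fin n) (Fin n) 𝕂, Vᴴ * V = A := by
  open scoped MatrixOrder in
  obtain ⟨V, hV⟩ := CStarAlgebra.nonneg_iff_eq_star_mul_self.1
    (Matrix.nonneg_iff_posSemidef.2 hA)
  exact ⟨V, hV.symm⟩

/-- The reduction step for a positive semidefinite `G` with constant determinant. If the diagonal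
of `G` is not constant, the matrix of leading coefficients (in degrees `m i + m j`, where
`2 * m i` is the degree of `G i i`) is singular. A vector `v` in its kernel, made homogeneous by
powers of `t`, replaces a basis vector of maximal `m i` with `v i ≠ 0`, and lowers the degree of
the corresponding diagonal entry. -/
theorem exists_sum_natDegree_lt {G : Matrix (Fin n) (Fin n) 𝕂[X]} (hG : G.IsHermitian)
    (hpos : IsPosSemidef G) (hdet : IsUnit G.det) (hne : ∃ i, (G i i).natDegree ≠ 0) :
    ∃ T : Matrix (Fin n) (Fin n) 𝕂[X], IsUnit T.det ∧
      ∑ i, ((Tᴴ * G * T) i i).natDegree < ∑ i, (G i i).natDegree := by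
  obtain ⟨m, hm, hmle⟩ := exists_natDegree_le hG hpos
  set L : Matrix (Fin n) (Fin n) 𝕂 := Matrix.of fun i j => (G i j).coeff (m i + m j) with hL
  have hL0 : L.det = 0 := by
    rw [hL, ← coeff_det_of_natDegree_le G m m hmle]
    refine coeff_eq_zero_of_natDegree_lt ?_
    rw [natDegree_eq_zero_of_isUnit hdet]
    obtain ⟨i, hi⟩ := hne
    have : m i ≤ ∑ i, m i := Finset.single_le_sum (fun _ _ => Nat.zero_le _) (Finset.mem_univ i)
    have := hm i
    omega
  obtain ⟨v, hv0, hv⟩ := Matrix.exists_mulVec_eq_zero_iff.2 hL0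
  obtain ⟨i, hi, hmax⟩ := Finset.exists_max_image (Finset.univ.filter fun i => v i ≠ 0) m
    (by
      obtain ⟨i, hi⟩ := Function.ne_iff.1 hv0
      exact ⟨i, Finset.mem_filter.2 ⟨Finset.mem_univ i, hi⟩⟩)
  have hvi : v i ≠ 0 := (Finset.mem_filter.1 hi).2
  have hmax' : ∀ j, v j ≠ 0 → m j ≤ m i := fun j hj =>
    hmax j (Finset.mem_filter.2 ⟨Finset.mem_univ j, hj⟩)
  set c : Fin n → 𝕂[X] := fun j => C (v j / v i) * X ^ (m i - m j) with hc
  set T : Matrix (Fin n) (Fin n) 𝕂[X] := (1 : Matrix (Fin n) (Fin n) 𝕂[X]).updateCol i c with hT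
  have hTdet : T.det = 1 := by
    rw [hT, ← Matrix.cramer_apply, Matrix.cramer_one]
    simp [hc, hvi]
  have hne' : ∀ j, j ≠ i → (Tᴴ * G * T) j j = G j j := by
    intro j hj
    simp [hT, Matrix.mul_apply, Matrix.conjTranspose_apply, hj,
      Matrix.one_apply, apply_ite star]
  have hii : (Tᴴ * G * T) i i = ∑ k, ∑ j, star (c j) * G j k * c k := by
    simp [hT, Matrix.mul_apply, Matrix.conjTranspose_apply, Finset.sum_mul]
  have hterm : ∀ j k, (star (c j) * G j k * c k).natDegree ≤ 2 * m i ∧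
      (star (c j) * G j k * c k).coeff (2 * m i) = star (v j / v i) * L j k * (v k / v i) := by
    intro j k
    have heq : star (c j) * G j k * c k =
        C (star (v j / v i) * (v k / v i)) * (X ^ ((m i - m j) + (m i - m k)) * G j k) := by
      rw [hc, star_C_mul_X_pow, C_mul, pow_add]; ring
    by_cases hz : v j = 0 ∨ v k = 0
    · have h0 : star (v j / v i) * (v k / v i) = 0 := by
        rcases hz with hz | hz <;> simp [hz]
      rw [heq, h0]
      refine ⟨by simp, ?_⟩
      rw [C_0, zero_mul, coeff_zero]
      linear_combination -L j k * h0
    · push Not at hz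
      have hj := hmax' j hz.1
      have hk := hmax' k hz.2
      have hjk := hmle j k
      rw [heq]
      constructor
      · refine (natDegree_C_mul_le _ _).trans (natDegree_mul_le.trans ?_)
        rw [natDegree_X_pow]
        omega
      · have hd : 2 * m i = (m j + m k) + ((m i - m j) + (m i - m k)) := by omega
        rw [coeff_C_mul, hd, coeff_X_pow_mul]
        simp only [hL, Matrix.of_apply]
        ring
  have hle : ((Tᴴ * G * T) i i).natDegree ≤ 2 * m i := by
    rw [hii]
    exact natDegree_sum_le_of_forall_le _ _ fun k _ =>
      natDegree_sum_le_of_forall_le _ _ fun j _ => (hterm j k).1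
  have hcoeff : ((Tᴴ * G * T) i i).coeff (2 * m i) = 0 := by
    rw [hii, Finset.sum_comm, finsetSum_coeff]
    refine Finset.sum_eq_zero fun j _ => ?_
    rw [finsetSum_coeff]
    have hvj : ∑ k, L j k * v k = 0 := congrFun hv j
    calc ∑ k, (star (c j) * G j k * c k).coeff (2 * m i)
        = ∑ k, star (v j / v i) / v i * (L j k * v k) :=
          Finset.sum_congr rfl fun k _ => by rw [(hterm j k).2]; ring
      _ = 0 := by rw [← Finset.mul_sum, hvj, mul_zero]
  have hT0 : (Tᴴ * G * T).det ≠ 0 := by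
    rw [Matrix.det_mul, Matrix.det_mul, Matrix.det_conjTranspose, hTdet, star_one, one_mul, mul_one]
    exact hdet.ne_zero
  -- if `m i = 0`, the entry itself would vanish, which definiteness excludes
  have hlt : ((Tᴴ * G * T) i i).natDegree < (G i i).natDegree := by
    rw [hm i]
    refine lt_of_le_of_ne hle fun heq => ?_
    rw [← heq] at hcoeff
    exact diag_ne_zero_of_isPosSemidef (hpos.conjTranspose_mul_mul_same T) hT0 i
      (leadingCoeff_eq_zero.1 hcoeff)
  refine ⟨T, by rw [hTdet]; exact isUnit_one, Finset.sum_lt_sum (fun j _ => ?_)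
    ⟨i, Finset.mem_univ i, hlt⟩⟩
  by_cases hj : j = i
  · rw [hj]; exact hlt.le
  · rw [hne' j hj]

/-- Every positive semidefinite matrix polynomial with constant nonzero determinant is congruent
to the identity matrix. -/
theorem exists_conjTranspose_mul_self_of_isUnit_det {G : Matrix (Fin n) (Fin n) 𝕂[X]}
    (hG : G.IsHermitian) (hpos : IsPosSemidef G) (hdet : IsUnit G.det) :
    ∃ U : Matrix (Fin n) (Fin n) 𝕂[X], Uᴴ * U = G := by
  induction hd : ∑ i, (G i i).natDegree using Nat.strong_induction_on generalizing G with
  | _ d ih =>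
  by_cases hne : ∃ i, (G i i).natDegree ≠ 0
  · obtain ⟨T, hT, hlt⟩ := exists_sum_natDegree_lt hG hpos hdet hne
    obtain ⟨U, hU⟩ := ih _ (hd ▸ hlt) (G := Tᴴ * G * T)
      (Matrix.isHermitian_conjTranspose_mul_mul T hG) (hpos.conjTranspose_mul_mul_same T)
      (by
        rw [Matrix.det_mul, Matrix.det_mul, Matrix.det_conjTranspose]
        exact (hT.star.mul hdet).mul hT) rfl
    refine ⟨U * T⁻¹, ?_⟩
    have h1 : T * T⁻¹ = 1 := Matrix.mul_nonsing_inv T hT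
    have h2 : (T⁻¹)ᴴ * Tᴴ = 1 := by
      rw [← Matrix.conjTranspose_mul, h1, Matrix.conjTranspose_one]
    calc (U * T⁻¹)ᴴ * (U * T⁻¹) = (T⁻¹)ᴴ * (Uᴴ * U) * T⁻¹ := by
          rw [Matrix.conjTranspose_mul]; simp only [Matrix.mul_assoc]
      _ = ((T⁻¹)ᴴ * Tᴴ) * G * (T * T⁻¹) := by rw [hU]; simp only [Matrix.mul_assoc]
      _ = G := by rw [h1, h2, Matrix.one_mul, Matrix.mul_one]
  · push Not at hne
    obtain ⟨m, hm, hmle⟩ := exists_natDegree_le hG hpos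
    have hconst : ∀ i j, G i j = C ((G i j).coeff 0) := fun i j => by
      refine eq_C_of_natDegree_le_zero ((hmle i j).trans ?_)
      have := hm i; have := hm j; have := hne i; have := hne j
      omega
    obtain ⟨V, hV⟩ := exists_conjTranspose_mul_self_of_posSemidef (hpos 0)
    refine ⟨V.map C, ?_⟩
    have hstar : (V.map C)ᴴ = Vᴴ.map (C : 𝕂 →+* 𝕂[X]) := by
      refine Matrix.ext fun i j => ?_
      have := star_C_mul_X_pow (V j i) 0
      simpa using this
    rw [hstar, ← Matrix.map_mul, hV]
    refine Matrix.ext fun i j => ?_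
    rw [hconst i j]
    simp only [Matrix.map_apply]
    rw [hconst i j]
    simp

end Unimodular

/-! ### Factorizations as self-dual lattices -/

section MatrixRange

variable {R : Type*} [CommRing R] {n : ℕ}

theorem exists_eq_mul_of_forall_mulVec_mem {A B : Matrix (Fin n) (Fin n) R}
    (h : ∀ v, A *ᵥ v ∈ LinearMap.range B.mulVecLin) : ∃ Z, A = B * Z := by
  choose z hz using fun j => h (Pi.single j 1)
  refine ⟨Matrix.of fun i j => z j i, Matrix.ext fun i j => ?_⟩
  have := congrFun (hz j) i
  rw [Matrix.mulVec_single_one] at this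
  exact this.symm

theorem range_mulVecLin_mul_le (A B : Matrix (Fin n) (Fin n) R) :
    LinearMap.range (A * B).mulVecLin ≤ LinearMap.range A.mulVecLin := by
  rintro _ ⟨v, rfl⟩
  exact ⟨B *ᵥ v, by simp⟩

theorem exists_range_mulVecLin_eq [IsDomain R] [IsPrincipalIdealRing R]
    (L : Submodule R (Fin n → R)) :
    ∃ B : Matrix (Fin n) (Fin n) R, LinearMap.range B.mulVecLin = L := by
  obtain ⟨m, b⟩ := Submodule.basisOfPid (Pi.basisFun R (Fin n)) L
  have hm : m ≤ n := by
    have h1 : LinearIndependent R fun i => (b i : Fin n → R) :=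
      b.linearIndependent.map' L.subtype (Submodule.ker_subtype L)
    simpa using h1.fintype_card_le_finrank
  refine ⟨Matrix.of fun i j => if h : (j : ℕ) < m then (b ⟨j, h⟩ : Fin n → R) i else 0, ?_⟩
  rw [Matrix.range_mulVecLin]
  apply le_antisymm
  · rw [Submodule.span_le]
    rintro _ ⟨j, rfl⟩
    by_cases h : (j : ℕ) < m
    · have hj : (fun i => if h : (j : ℕ) < m then (b ⟨j, h⟩ : Fin n → R) i else 0) =
          (b ⟨j, h⟩ : Fin n → R) := by
        ext i
        simp [h]
      exact (congrArg (· ∈ L) hj).mpr (b ⟨j, h⟩).2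
    · have hj : (fun i => if h : (j : ℕ) < m then (b ⟨j, h⟩ : Fin n → R) i else 0) = 0 := by
        ext i
        simp [h]
      exact (congrArg (· ∈ L) hj).mpr L.zero_mem
  · intro v hv
    have h1 : v = ∑ j, b.repr ⟨v, hv⟩ j • (b j : Fin n → R) := by
      have := congrArg L.subtype (b.sum_repr ⟨v, hv⟩)
      rw [map_sum] at this
      exact this.symm
    rw [h1]
    refine Submodule.sum_mem _ fun j _ => Submodule.smul_mem _ _ (Submodule.subset_span
      ⟨⟨j, j.2.trans_le hm⟩, ?_⟩)
    ext i
    simp [Matrix.col_apply]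

theorem isRegular_of_det_ne_zero [IsDomain R] {A : Matrix (Fin n) (Fin n) R} (hA : A.det ≠ 0) :
    IsRegular A :=
  Matrix.isRegular_of_isLeftRegular_det (IsLeftCancelMulZero.mul_left_cancel_of_ne_zero hA)

end MatrixRange

section Lattice

variable {R : Type*} [CommRing R] [StarRing R] {n : ℕ}

/-- A submodule `L` of `Rⁿ` is self-dual with respect to the sesquilinear form
`(v, w) ↦ v* W w` with values modulo `d` if it equals its own orthogonal complement. For
`W = adj M` and `d = det M` this form represents `v* M⁻¹ w` modulo `R`. -/
def IsSelfDual (W : Matrix (Fin n) (Fin n) R) (d : R) (L : Submodule R (Fin n → R)) : Prop :=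
  ∀ v, v ∈ L ↔ ∀ w ∈ L, d ∣ star v ⬝ᵥ W *ᵥ w

theorem IsSelfDual.smul_mem {W : Matrix (Fin n) (Fin n) R} {d : R} {L : Submodule R (Fin n → R)}
    (hL : IsSelfDual W d L) (hd : star d = d) (v : Fin n → R) : d • v ∈ L := by
  refine (hL _).2 fun w _ => ?_
  rw [star_smul, hd, smul_dotProduct, smul_eq_mul]
  exact dvd_mul_right _ _

/-- Mutually inverse maps modulo `d` that respect the forms of `W'` and `W` modulo `d` identify
the self-dual lattices by taking preimages. -/
def selfDualEquiv {W W' : Matrix (Fin n) (Fin n) R} {d e : R} (hd : star d = d) (he : star e = e)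
    (hde : Associated d e)
    {A B : Matrix (Fin n) (Fin n) R} (hAB : ∀ v, ∃ u, A *ᵥ (B *ᵥ v) = v + d • u)
    (hBA : ∀ v, ∃ u, B *ᵥ (A *ᵥ v) = v + d • u)
    (hA : ∀ v w, d ∣ star (A *ᵥ v) ⬝ᵥ W *ᵥ (A *ᵥ w) ↔ e ∣ star v ⬝ᵥ W' *ᵥ w) :
    {L : Submodule R (Fin n → R) // IsSelfDual W d L} ≃
      {L : Submodule R (Fin n → R) // IsSelfDual W' e L} := by
  have hB : ∀ v w, e ∣ star (B *ᵥ v) ⬝ᵥ W' *ᵥ (B *ᵥ w) ↔ d ∣ star v ⬝ᵥ W *ᵥ w := by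
    intro v w
    obtain ⟨x, hx⟩ := hAB v
    obtain ⟨y, hy⟩ := hAB w
    rw [← hA, hx, hy, star_add, star_smul, hd, add_dotProduct, smul_dotProduct, Matrix.mulVec_add,
      dotProduct_add, Matrix.mulVec_smul, dotProduct_smul, smul_eq_mul, smul_eq_mul,
      dvd_add_left (dvd_mul_right _ _), dvd_add_left (dvd_mul_right _ _)]
  have hmem : ∀ {L : Submodule R (Fin n → R)}, (∀ v, d • v ∈ L) →
      ∀ {x v : Fin n → R}, (∃ u, x = v + d • u) → (x ∈ L ↔ v ∈ L) := by
    rintro L hL x v ⟨u, rfl⟩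
    exact L.add_mem_iff_left (hL u)
  have hmem' : ∀ {L : Submodule R (Fin n → R)}, IsSelfDual W' e L → ∀ v, d • v ∈ L := by
    intro L hL v
    obtain ⟨r, hr⟩ := hde.symm.dvd
    rw [hr, mul_smul]
    exact hL.smul_mem he _
  refine
  { toFun := fun L => ⟨L.1.comap A.mulVecLin, fun v => ?_⟩
    invFun := fun L => ⟨L.1.comap B.mulVecLin, fun v => ?_⟩
    left_inv := fun L => Subtype.ext (Submodule.ext fun v =>
      hmem (L.2.smul_mem hd) (hAB v))
    right_inv := fun L => Subtype.ext (Submodule.ext fun v =>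
      hmem (hmem' L.2) (hBA v)) }
  · have hd' := L.2.smul_mem hd
    simp only [Submodule.mem_comap, Matrix.mulVecLin_apply]
    rw [L.2]
    refine ⟨fun h w hw => (hA v w).1 (h _ hw), fun h w hw => ?_⟩
    have h1 := (hA v (B *ᵥ w)).2 (h _ ((hmem hd' (hAB w)).2 hw))
    obtain ⟨u, hu⟩ := hAB w
    rw [hu, Matrix.mulVec_add, dotProduct_add, Matrix.mulVec_smul, dotProduct_smul,
      smul_eq_mul] at h1
    exact (dvd_add_left (dvd_mul_right _ _)).1 h1
  · have hd' := hmem' L.2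
    simp only [Submodule.mem_comap, Matrix.mulVecLin_apply]
    rw [L.2]
    refine ⟨fun h w hw => (hB v w).1 (h _ hw), fun h w hw => ?_⟩
    have h1 := (hB v (A *ᵥ w)).2 (h _ ((hmem hd' (hBA w)).2 hw))
    obtain ⟨u, hu⟩ := hBA w
    rw [hu, Matrix.mulVec_add, dotProduct_add, Matrix.mulVec_smul, dotProduct_smul,
      smul_eq_mul] at h1
    exact (dvd_add_left (hde.symm.dvd.trans (dvd_mul_right _ _))).1 h1

/-- The lattice spanned by the columns of `Qᴴ` is self-dual for the form of `M = Qᴴ * Q`. -/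
theorem isSelfDual_range [IsDomain R] {M Q : Matrix (Fin n) (Fin n) R} (hQ : Qᴴ * Q = M)
    (hdet : M.det ≠ 0) :
    IsSelfDual M.adjugate M.det (LinearMap.range Qᴴ.mulVecLin) := by
  have hd : M.det = Qᴴ.det * Q.det := by rw [← hQ, Matrix.det_mul]
  have hQ1 : Qᴴ.det ≠ 0 := left_ne_zero_of_mul (hd ▸ hdet)
  have hQ2 : Q.det ≠ 0 := right_ne_zero_of_mul (hd ▸ hdet)
  have hform : ∀ v b, star v ⬝ᵥ M.adjugate *ᵥ (Qᴴ *ᵥ b) =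
      Qᴴ.det * (star v ⬝ᵥ Q.adjugate *ᵥ b) := by
    intro v b
    rw [← hQ, Matrix.adjugate_mul_distrib, Matrix.mulVec_mulVec, Matrix.mul_assoc,
      Matrix.adjugate_mul, Matrix.mul_smul, Matrix.mul_one, Matrix.smul_mulVec, dotProduct_smul,
      smul_eq_mul]
  intro v
  constructor
  · rintro ⟨a, rfl⟩ _ ⟨b, rfl⟩
    rw [Matrix.mulVecLin_apply, Matrix.mulVecLin_apply, hform, hd]
    refine mul_dvd_mul_left _ ⟨star a ⬝ᵥ b, ?_⟩
    rw [Matrix.star_mulVec, Matrix.conjTranspose_conjTranspose, ← Matrix.dotProduct_mulVec,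
      Matrix.mulVec_mulVec, Matrix.mul_adjugate, Matrix.smul_mulVec, Matrix.one_mulVec,
      dotProduct_smul, smul_eq_mul]
  · intro h
    have h1 : ∀ j, Q.det ∣ (star v ᵥ* Q.adjugate) j := by
      intro j
      have h2 := h _ ⟨Pi.single j 1, rfl⟩
      rw [Matrix.mulVecLin_apply, hform, hd, mul_dvd_mul_iff_left hQ1, Matrix.dotProduct_mulVec,
        dotProduct_single, mul_one] at h2
      exact h2
    choose c hc using h1
    have h3 : star v = c ᵥ* Q := by
      have h4 : Q.det • star v = Q.det • (c ᵥ* Q) := by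
        rw [← Matrix.smul_vecMul, ← (funext hc : star v ᵥ* Q.adjugate = Q.det • c),
          Matrix.vecMul_vecMul, Matrix.adjugate_mul, Matrix.vecMul_smul, Matrix.vecMul_one]
      funext i
      exact mul_left_cancel₀ hQ2 (congrFun h4 i)
    refine ⟨star c, ?_⟩
    rw [Matrix.mulVecLin_apply, ← star_star v, h3, Matrix.star_vecMul]

/-- Factorizations that span the same lattice differ by a unitary matrix. -/
theorem exists_unitary_of_range_eq [IsDomain R] {M Q P : Matrix (Fin n) (Fin n) R}
    (hQ : Qᴴ * Q = M) (hP : Pᴴ * P = M) (hdet : M.det ≠ 0)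
    (h : LinearMap.range Qᴴ.mulVecLin = LinearMap.range Pᴴ.mulVecLin) :
    ∃ U ∈ Matrix.unitaryGroup (Fin n) R, U * Q = P := by
  obtain ⟨A, hA⟩ := exists_eq_mul_of_forall_mulVec_mem (A := Pᴴ) (B := Qᴴ)
    fun v => h ▸ LinearMap.mem_range_self Pᴴ.mulVecLin v
  have hPA : P = Aᴴ * Q := by
    rw [← Matrix.conjTranspose_conjTranspose P, hA, Matrix.conjTranspose_mul,
      Matrix.conjTranspose_conjTranspose]
  refine ⟨Aᴴ, Matrix.mem_unitaryGroup_iff'.2 ?_, hPA.symm⟩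
  have hd : M.det = Qᴴ.det * Q.det := by rw [← hQ, Matrix.det_mul]
  have hQ1 := isRegular_of_det_ne_zero (left_ne_zero_of_mul (hd ▸ hdet))
  have hQ2 := isRegular_of_det_ne_zero (right_ne_zero_of_mul (hd ▸ hdet))
  have h1 : Qᴴ * (A * Aᴴ * Q) = Qᴴ * (1 * Q) := by
    calc Qᴴ * (A * Aᴴ * Q) = (Qᴴ * A) * (Aᴴ * Q) := by simp only [Matrix.mul_assoc]
      _ = Qᴴ * (1 * Q) := by rw [← hA, ← hPA, hP, Matrix.one_mul, hQ]
  have h2 : A * Aᴴ = 1 := hQ2.right (hQ1.left h1)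
  rwa [Matrix.star_eq_conjTranspose, Matrix.conjTranspose_conjTranspose]

/-- Congruent matrices have the same factorizations up to right multiplication. -/
def facCongr {M : Matrix (Fin n) (Fin n) R}
    (T T' : Matrix (Fin n) (Fin n) R) (hT : T * T' = 1) : Fac M n ≃ Fac (Tᴴ * M * T) n :=
  Quotient.congr
    { toFun := fun Q => ⟨Q.1 * T, by
        calc (Q.1 * T)ᴴ * (Q.1 * T) = Tᴴ * (Q.1ᴴ * Q.1) * T := by
              rw [Matrix.conjTranspose_mul]; simp only [Matrix.mul_assoc]
          _ = Tᴴ * M * T := by rw [Q.2]⟩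
      invFun := fun Q => ⟨Q.1 * T', by
        have h : T'ᴴ * Tᴴ = 1 := by rw [← Matrix.conjTranspose_mul, hT, Matrix.conjTranspose_one]
        calc (Q.1 * T')ᴴ * (Q.1 * T') = T'ᴴ * (Q.1ᴴ * Q.1) * T' := by
              rw [Matrix.conjTranspose_mul]; simp only [Matrix.mul_assoc]
          _ = (T'ᴴ * Tᴴ) * M * (T * T') := by rw [Q.2]; simp only [Matrix.mul_assoc]
          _ = M := by rw [h, hT, Matrix.one_mul, Matrix.mul_one]⟩
      left_inv := fun Q => Subtype.ext (by
        change Q.1 * T * T' = Q.1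
        rw [Matrix.mul_assoc, hT, Matrix.mul_one])
      right_inv := fun Q => Subtype.ext (by
        change Q.1 * T' * T = Q.1
        rw [Matrix.mul_assoc, mul_eq_one_comm.1 hT, Matrix.mul_one]) }
    (by
      intro Q P
      constructor
      · rintro ⟨U, hU, h⟩
        exact ⟨U, hU, by
          change U * (Q.1 * T) = P.1 * T
          rw [← Matrix.mul_assoc, h]⟩
      · rintro ⟨U, hU, h⟩
        refine ⟨U, hU, ?_⟩
        change U * (Q.1 * T) = P.1 * T at h
        have h' := congrArg (· * T') h
        simp only [Matrix.mul_assoc, hT, Matrix.mul_one] at h'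
        exact h')

end Lattice

section Factorization

variable {𝕂 : Type*} [RCLike 𝕂] {n : ℕ}

/-- If `M = Zᴴ * H * Z` is positive semidefinite with `det Z ≠ 0`, then so is `H`: this is clear
where `Z` is invertible, and positive semidefiniteness is a closed condition. -/
theorem isPosSemidef_of_conjTranspose_mul_mul {M H Z : Matrix (Fin n) (Fin n) 𝕂[X]}
    (hM : IsPosSemidef M) (h : Zᴴ * H * Z = M) (hZ : Z.det ≠ 0) : IsPosSemidef H := by
  intro x
  refine forall_mem_of_isClosed (s := {x | (evalMatrix x H).PosSemidef}) hZ
    (isClosed_setOf_posSemidef.preimage (continuous_evalMatrix H)) (fun t ht => ?_) x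
  have hu : IsUnit (evalMatrix t Z).det := by
    rw [det_evalMatrix]; exact isUnit_iff_ne_zero.2 ht
  have h1 : evalMatrix t Z * (evalMatrix t Z)⁻¹ = 1 := Matrix.mul_nonsing_inv _ hu
  have h2 : ((evalMatrix t Z)⁻¹)ᴴ * (evalMatrix t Z)ᴴ = 1 := by
    rw [← Matrix.conjTranspose_mul, h1, Matrix.conjTranspose_one]
  have h3 := (isPosSemidef_iff.1 hM t).conjTranspose_mul_mul_same (evalMatrix t Z)⁻¹
  rw [← h, map_mul, map_mul, evalMatrix_conjTranspose] at h3
  have h4 : ((evalMatrix t Z)⁻¹)ᴴ * ((evalMatrix t Z)ᴴ * evalMatrix t H * evalMatrix t Z) *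
      (evalMatrix t Z)⁻¹ = evalMatrix t H := by
    calc _ = (((evalMatrix t Z)⁻¹)ᴴ * (evalMatrix t Z)ᴴ) * evalMatrix t H *
          (evalMatrix t Z * (evalMatrix t Z)⁻¹) := by simp only [Matrix.mul_assoc]
      _ = _ := by rw [h1, h2, Matrix.one_mul, Matrix.mul_one]
  rwa [h4] at h3

/-- Every self-dual lattice `L` comes from a factorization. If the columns of `A` span `L`, then
`M = A * Z`, and `H = Aᴴ * M⁻¹ * A` has polynomial entries and satisfies `M = Zᴴ * H * Z`.
Self-duality makes `H` unimodular, so that `H = Uᴴ * U`, and `U * Z` is the factorization. -/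
theorem exists_factorization_of_isSelfDual {M : Matrix (Fin n) (Fin n) 𝕂[X]}
    (hM : M.IsHermitian) (hpos : IsPosSemidef M) (hdet : M.det ≠ 0)
    {L : Submodule 𝕂[X] (Fin n → 𝕂[X])} (hL : IsSelfDual M.adjugate M.det L) :
    ∃ Q : Matrix (Fin n) (Fin n) 𝕂[X], Qᴴ * Q = M ∧ LinearMap.range Qᴴ.mulVecLin = L := by
  have hdstar : star M.det = M.det := by rw [← Matrix.det_conjTranspose, hM.eq]
  obtain ⟨A, hA⟩ := exists_range_mulVecLin_eq L
  have hAL : ∀ v, A *ᵥ v ∈ L := fun v => hA ▸ LinearMap.mem_range_self A.mulVecLin v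
  obtain ⟨Z, hZ⟩ := exists_eq_mul_of_forall_mulVec_mem (A := M) (B := A) fun v => by
    rw [hA, hL]
    intro w _
    rw [Matrix.star_mulVec, hM.eq, ← Matrix.dotProduct_mulVec, Matrix.mulVec_mulVec,
      Matrix.mul_adjugate, Matrix.smul_mulVec, dotProduct_smul, smul_eq_mul]
    exact dvd_mul_right _ _
  have hA0 : A.det ≠ 0 := by
    intro h0; rw [hZ, Matrix.det_mul, h0, zero_mul] at hdet; exact hdet rfl
  have hZ0 : Z.det ≠ 0 := by
    intro h0; rw [hZ, Matrix.det_mul, h0, mul_zero] at hdet; exact hdet rfl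
  have hAreg := isRegular_of_det_ne_zero hA0
  have hcancel : ∀ {B C : Matrix (Fin n) (Fin n) 𝕂[X]}, M.det • B = M.det • C → B = C :=
    fun h => Matrix.ext fun i j => mul_left_cancel₀ hdet (congrFun (congrFun h i) j)
  have hentry : ∀ i j, M.det ∣ (Aᴴ * M.adjugate * A) i j := by
    intro i j
    have h := (hL _).1 (hAL (Pi.single i 1)) _ (hAL (Pi.single j 1))
    rw [Matrix.star_mulVec, ← Matrix.dotProduct_mulVec, Matrix.mulVec_mulVec, Matrix.mulVec_mulVec,
      ← Pi.single_star, star_one, single_one_dotProduct, Matrix.mulVec_single_one] at h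
    exact h
  choose H' hH' using hentry
  obtain ⟨H, hH⟩ : ∃ H : Matrix (Fin n) (Fin n) 𝕂[X], Aᴴ * M.adjugate * A = M.det • H :=
    ⟨Matrix.of H', Matrix.ext fun i j => hH' i j⟩
  have hHherm : Hᴴ = H := by
    apply hcancel
    rw [← hH, ← hdstar, ← Matrix.conjTranspose_smul, ← hH]
    exact Matrix.isHermitian_conjTranspose_mul_mul A hM.adjugate
  have hHZ : H * Z = Aᴴ := by
    apply hcancel
    rw [← Matrix.smul_mul, ← hH, Matrix.mul_assoc _ A Z, ← hZ, Matrix.mul_assoc,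
      Matrix.adjugate_mul, Matrix.mul_smul, Matrix.mul_one]
  have hAZ : A = Zᴴ * H := by
    rw [← Matrix.conjTranspose_conjTranspose A, ← hHZ, Matrix.conjTranspose_mul, hHherm]
  have hZA : Z * M.adjugate * A = M.det • (1 : Matrix (Fin n) (Fin n) 𝕂[X]) := by
    apply hAreg.left
    change A * (Z * M.adjugate * A) = A * (M.det • 1)
    rw [← Matrix.mul_assoc, ← Matrix.mul_assoc, ← hZ, Matrix.mul_adjugate, Matrix.smul_mul,
      Matrix.one_mul, Matrix.mul_smul, Matrix.mul_one]
  obtain ⟨Y, hY⟩ := exists_eq_mul_of_forall_mulVec_mem (A := Zᴴ) (B := A) fun v => by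
    rw [hA, hL]
    intro w hw
    obtain ⟨b, rfl⟩ : ∃ b, A *ᵥ b = w := by rw [← hA] at hw; exact hw
    rw [Matrix.star_mulVec, Matrix.conjTranspose_conjTranspose, ← Matrix.dotProduct_mulVec,
      Matrix.mulVec_mulVec, Matrix.mulVec_mulVec, hZA, Matrix.smul_mulVec,
      dotProduct_smul, smul_eq_mul]
    exact dvd_mul_right _ _
  have hYH : Y * H = 1 := by
    apply hAreg.left
    change A * (Y * H) = A * 1
    rw [← Matrix.mul_assoc, ← hY, ← hAZ, Matrix.mul_one]
  have hMZ : Zᴴ * H * Z = M := by rw [← hAZ, ← hZ]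
  obtain ⟨U, hU⟩ := exists_conjTranspose_mul_self_of_isUnit_det hHherm
    (isPosSemidef_of_conjTranspose_mul_mul hpos hMZ hZ0)
    (Matrix.isUnit_det_of_left_inverse hYH)
  refine ⟨U * Z, ?_, le_antisymm ?_ ?_⟩
  · rw [Matrix.conjTranspose_mul, ← hMZ, ← hU]
    simp only [Matrix.mul_assoc]
  · rw [Matrix.conjTranspose_mul, hY, Matrix.mul_assoc, ← hA]
    exact range_mulVecLin_mul_le _ _
  · rw [← hA]
    conv_lhs => rw [hAZ, ← hU, ← Matrix.mul_assoc, ← Matrix.conjTranspose_mul]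
    exact range_mulVecLin_mul_le _ _

/-- The class of a factorization `M = Qᴴ * Q` is determined by the lattice spanned by the columns
of `Qᴴ`, and these lattices are exactly the self-dual ones. -/
noncomputable def facEquivSelfDual {M : Matrix (Fin n) (Fin n) 𝕂[X]} (hM : M.IsHermitian)
    (hpos : IsPosSemidef M) (hdet : M.det ≠ 0) :
    Fac M n ≃ {L : Submodule 𝕂[X] (Fin n → 𝕂[X]) // IsSelfDual M.adjugate M.det L} :=
  Equiv.ofBijective
    (Quotient.lift (fun Q => ⟨LinearMap.range Q.1ᴴ.mulVecLin, isSelfDual_range Q.2 hdet⟩)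
      (by
        rintro Q P ⟨U, hU, h⟩
        refine Subtype.ext (le_antisymm ?_ ?_)
        · have hQ : Q.1 = Uᴴ * P.1 := by
            rw [← h, ← Matrix.mul_assoc, ← Matrix.star_eq_conjTranspose,
              Matrix.mem_unitaryGroup_iff'.1 hU, Matrix.one_mul]
          simp only [hQ, Matrix.conjTranspose_mul]
          exact range_mulVecLin_mul_le _ _
        · simp only [← h, Matrix.conjTranspose_mul]
          exact range_mulVecLin_mul_le _ _))
    (by
      constructor
      · intro q p
        induction q using Quotient.inductionOn with
        | h Q =>
          induction p using Quotient.inductionOn with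
          | h P =>
            intro h
            exact Quotient.sound (exists_unitary_of_range_eq Q.2 P.2 hdet (Subtype.ext_iff.1 h))
      · rintro ⟨L, hL⟩
        obtain ⟨Q, hQ, hQL⟩ := exists_factorization_of_isSelfDual hM hpos hdet hL
        exact ⟨Quotient.mk _ ⟨Q, hQ⟩, Subtype.ext hQL⟩)

end Factorization

/-! ### Square roots in finite-dimensional real algebras -/

/-- A unit of a finite-dimensional commutative real algebra is a square if no real character is
negative on it. It is a square in each residue field, which is `ℝ` or `ℂ`; by the Chinese
remainder theorem it is a square modulo the nilradical, and Newton's method lifts the root. -/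
theorem exists_sq_eq_of_algHom_nonneg {A : Type*} [CommRing A] [Algebra ℝ A] [Module.Finite ℝ A]
    {y : A} (hy : IsUnit y) (hpos : ∀ χ : A →ₐ[ℝ] ℝ, 0 ≤ χ y) : ∃ s, s ^ 2 = y := by
  have : IsArtinianRing A := IsArtinianRing.of_finite ℝ A
  have hres : ∀ m : MaximalSpectrum A, ∃ r : A ⧸ m.asIdeal,
      r ^ 2 = Ideal.Quotient.mk m.asIdeal y := by
    intro m
    have := m.isMaximal
    let : Field (A ⧸ m.asIdeal) := Ideal.Quotient.field m.asIdeal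
    have : Module.Finite ℝ (A ⧸ m.asIdeal) :=
      Module.Finite.of_surjective (Ideal.Quotient.mkₐ ℝ m.asIdeal).toLinearMap
        Ideal.Quotient.mk_surjective
    have : Algebra.IsAlgebraic ℝ (A ⧸ m.asIdeal) := Algebra.IsAlgebraic.of_finite ℝ _
    rcases Real.nonempty_algEquiv_or (A ⧸ m.asIdeal) with ⟨⟨e⟩⟩ | ⟨⟨e⟩⟩
    · have h := hpos (e.toAlgHom.comp (Ideal.Quotient.mkₐ ℝ m.asIdeal))
      refine ⟨e.symm (Real.sqrt (e (Ideal.Quotient.mk m.asIdeal y))), ?_⟩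
      rw [← map_pow, Real.sq_sqrt (show 0 ≤ e (Ideal.Quotient.mk m.asIdeal y) from h),
        e.symm_apply_apply]
    · obtain ⟨z, hz⟩ := IsAlgClosed.exists_pow_nat_eq (e (Ideal.Quotient.mk m.asIdeal y))
        zero_lt_two
      exact ⟨e.symm z, by rw [← map_pow, hz, e.symm_apply_apply]⟩
  choose r hr using hres
  have hcop : Pairwise (Function.onFun IsCoprime fun m : MaximalSpectrum A => m.asIdeal) :=
    fun m m' hne => by
      have := m.isMaximal
      have := m'.isMaximal
      exact Ideal.isCoprime_of_isMaximal fun h => hne (MaximalSpectrum.ext h)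
  obtain ⟨s, hs⟩ := Ideal.pi_quotient_surjective hcop r
  have hnil : IsNilpotent (s ^ 2 - y) := by
    rw [← mem_nilradical, nilradical_eq_sInf, Ideal.mem_sInf]
    intro I hI
    have hI' : I.IsPrime := hI
    have : I.IsMaximal := IsArtinianRing.isMaximal_of_isPrime I
    rw [← Ideal.Quotient.eq_zero_iff_mem, map_sub, map_pow, hs ⟨I, this⟩, hr ⟨I, this⟩, sub_self]
  have hsu : IsUnit s := by
    have h1 : IsUnit (s ^ 2) := by
      have := hnil.isUnit_add_left_of_commute hy (Commute.all _ _)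
      rwa [add_sub_cancel] at this
    exact (isUnit_pow_iff two_ne_zero).1 h1
  obtain ⟨t, ⟨-, ht⟩, -⟩ := existsUnique_nilpotent_sub_and_aeval_eq_zero
    (P := (X ^ 2 - C y : A[X])) (x := s) (by simpa using hnil) (by
      have h2 : IsUnit (2 : A) := by
        have := (isUnit_iff_ne_zero.2 (two_ne_zero (α := ℝ))).map (algebraMap ℝ A)
        rwa [map_ofNat] at this
      simpa [one_add_one_eq_two] using h2.mul hsu)
  refine ⟨t, ?_⟩
  simpa [sub_eq_zero] using ht

section MatrixRoot

variable {𝕂 : Type*} [RCLike 𝕂] {n : ℕ}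

/-- Substitution of a matrix polynomial `P` for the variable of a polynomial with coefficients
in `ℝ[t]`. -/
noncomputable def realAeval (P : Matrix (Fin n) (Fin n) 𝕂[X]) :
    ℝ[X][X] →+* Matrix (Fin n) (Fin n) 𝕂[X] :=
  (aeval P : 𝕂[X][X] →ₐ[𝕂[X]] Matrix (Fin n) (Fin n) 𝕂[X]).toRingHom.comp
    (mapRingHom (mapRingHom (algebraMap ℝ 𝕂)))

theorem realAeval_X (P : Matrix (Fin n) (Fin n) 𝕂[X]) : realAeval P X = P := by
  simp [realAeval]

theorem realAeval_C_mul (P : Matrix (Fin n) (Fin n) 𝕂[X]) (q : ℝ[X]) (s : ℝ[X][X]) :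
    realAeval P (C q * s) = q.map (algebraMap ℝ 𝕂) • realAeval P s := by
  simp [realAeval, Algebra.smul_def]

/-- Real polynomials in `P` inherit the relation `P * D = D * Pᴴ`. -/
theorem realAeval_mul_eq {P D : Matrix (Fin n) (Fin n) 𝕂[X]} (h : P * D = D * Pᴴ)
    (s : ℝ[X][X]) : realAeval P s * D = D * (realAeval P s)ᴴ := by
  induction s using Polynomial.induction_on' with
  | add p q hp hq => rw [map_add, Matrix.conjTranspose_add, Matrix.add_mul, Matrix.mul_add, hp, hq]
  | monomial k q =>
    rw [← C_mul_X_pow_eq_monomial, realAeval_C_mul, map_pow, realAeval_X,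
      Matrix.conjTranspose_smul, star_map_ofReal, Matrix.conjTranspose_pow, Matrix.smul_mul,
      Matrix.mul_smul]
    have : SemiconjBy D Pᴴ P := h.symm
    rw [(this.pow_right k).eq]

theorem commute_realAeval (P : Matrix (Fin n) (Fin n) 𝕂[X]) (s t : ℝ[X][X]) :
    Commute (realAeval P s) (realAeval P t) :=
  (Commute.all s t).map (realAeval P)

/-- A matrix polynomial `P` with real characteristic polynomial and constant determinant, none of
whose values at real points has an eigenvalue `≤ 0`, is a square modulo any nonzero real
polynomial `d`; both the square root and the error term are real polynomials in `P`. This is the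
existence of square roots in the finite-dimensional real algebra `ℝ[t][z] / (d, charpoly P)`. -/
theorem exists_sq_eq_add_smul {P : Matrix (Fin n) (Fin n) 𝕂[X]} (hP : IsUnit P.det)
    (hreal : ∀ i, star (P.charpoly.coeff i) = P.charpoly.coeff i)
    (hpos : ∀ x l : ℝ, l ≤ 0 → (evalMatrix x P).charpoly.eval (l : 𝕂) ≠ 0)
    {d : ℝ[X]} (hd : d ≠ 0) :
    ∃ s e : ℝ[X][X],
      realAeval P s ^ 2 = P + d.map (algebraMap ℝ 𝕂) • realAeval P e := by
  obtain ⟨c, hc⟩ : ∃ c : ℝ[X][X], c.map (mapRingHom (algebraMap ℝ 𝕂)) = P.charpoly := by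
    rw [← Polynomial.mem_lifts, Polynomial.lifts_iff_coeff_lifts]
    intro i
    obtain ⟨q, hq⟩ := exists_real_of_star_eq (hreal i)
    exact ⟨q, hq⟩
  have hcmon : c.Monic := by
    refine monic_of_injective (f := mapRingHom (algebraMap ℝ 𝕂))
      (map_injective _ (algebraMap ℝ 𝕂).injective) ?_
    rw [hc]; exact P.charpoly_monic
  have hc0 : IsUnit (c.coeff 0) := by
    have h1 : (c.coeff 0).map (algebraMap ℝ 𝕂) = P.charpoly.coeff 0 := by
      rw [← hc, coeff_map]; rfl
    have h2 : IsUnit (P.charpoly.coeff 0) := by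
      rw [Matrix.det_eq_sign_charpoly_coeff] at hP
      exact isUnit_of_mul_isUnit_right hP
    rw [← h1] at h2
    rw [isUnit_iff_degree_eq_zero] at h2 ⊢
    rwa [degree_map] at h2
  have hcroot : realAeval P c = 0 := by
    change aeval P (c.map (mapRingHom (algebraMap ℝ 𝕂))) = 0
    rw [hc]; exact P.aeval_self_charpoly
  -- `A` is `ℝ[t][z] / (d, c)`, built in two steps to see that it is finite over `ℝ`
  let π : ℝ[X] →+* AdjoinRoot d := AdjoinRoot.mk d
  have hπ : Function.Surjective π := AdjoinRoot.mk_surjective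
  let A := AdjoinRoot (c.map π)
  let ψ : ℝ[X][X] →+* A := (AdjoinRoot.mk (c.map π)).comp (mapRingHom π)
  have : Module.Finite ℝ (AdjoinRoot d) := (AdjoinRoot.powerBasis hd).finite
  have : Module.Finite (AdjoinRoot d) A := (hcmon.map π).finite_adjoinRoot
  have : Module.Finite ℝ A := Module.Finite.trans (AdjoinRoot d) A
  have hψc : ψ c = 0 := AdjoinRoot.mk_self
  have hunit : IsUnit (ψ X) := by
    have h1 : ψ c.divX * ψ X + ψ (C (c.coeff 0)) = 0 := by
      rw [← map_mul, ← map_add, divX_mul_X_add, hψc]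
    have h2 : IsUnit (ψ c.divX * ψ X) := by
      rw [eq_neg_of_add_eq_zero_left h1]
      exact ((hc0.map C).map ψ).neg
    exact isUnit_of_mul_isUnit_right h2
  obtain ⟨y, hy⟩ := exists_sq_eq_of_algHom_nonneg (A := A) hunit (by
    intro χ
    by_contra! hneg
    -- the character sends `t` to a real number `x` and `z` to an eigenvalue of `P(x)`
    let x : ℝ := χ (ψ (C X))
    have hhom : (χ : A →+* ℝ).comp ψ =
        (evalRingHom (χ (ψ X))).comp (mapRingHom (evalRingHom x)) := by
      refine Polynomial.ringHom_ext' (Polynomial.ringHom_ext' ?_ ?_) ?_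
      · exact Subsingleton.elim _ _
      · simp [x]
      · simp
    have h1 : (c.map (evalRingHom x)).eval (χ (ψ X)) = 0 := by
      have := congrArg (fun f => f c) hhom
      simp only [RingHom.comp_apply, hψc, map_zero] at this
      exact this.symm
    refine hpos x _ hneg.le ?_
    have h2 : (evalMatrix x P).charpoly =
        (c.map (evalRingHom x)).map (algebraMap ℝ 𝕂) := by
      have h3 : (evalMatrix x P).charpoly = P.charpoly.map (evalRingHom (x : 𝕂)) :=
        Matrix.charpoly_map P (evalRingHom (x : 𝕂))
      rw [h3, ← hc, Polynomial.map_map, Polynomial.map_map]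
      congr 1
      refine Polynomial.ringHom_ext' ?_ ?_
      · ext; simp
      · simp
    rw [h2, eval_map_ofReal, h1, RCLike.ofReal_zero])
  obtain ⟨y', rfl⟩ := AdjoinRoot.mk_surjective y
  obtain ⟨s, rfl⟩ := map_surjective π hπ y'
  have hdvd : c.map π ∣ (s ^ 2 - X).map π := by
    rw [← AdjoinRoot.mk_eq_zero]
    have : ψ (s ^ 2 - X) = 0 := by
      rw [map_sub, map_pow, sub_eq_zero]; exact hy
    exact this
  obtain ⟨b', hb'⟩ := hdvd
  obtain ⟨b, rfl⟩ := map_surjective π hπ b'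
  have hCd : C d ∣ s ^ 2 - X - c * b := by
    rw [C_dvd_iff_dvd_coeff]
    intro i
    rw [← AdjoinRoot.mk_eq_zero]
    change π _ = 0
    rw [← coeff_map, Polynomial.map_sub, hb', Polynomial.map_mul, sub_self, coeff_zero]
  obtain ⟨e, he⟩ := hCd
  refine ⟨s, e, ?_⟩
  have h1 : s ^ 2 = X + C d * e + c * b := by linear_combination he
  rw [← map_pow, h1, map_add, map_add, map_mul (realAeval P) c b, hcroot, zero_mul, add_zero,
    realAeval_X, realAeval_C_mul]

/-- If `P * diagonal a` is positive semidefinite with `P` invertible and nonnegative real `a i`,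
then the values of `P` at real points have no eigenvalue `l ≤ 0`. Where all `a i` are positive,
`P` is similar to a positive semidefinite matrix, so `|det (l - P)| ≥ |det P|`; this inequality
extends to all real points by continuity. -/
theorem eval_charpoly_ne_zero {P : Matrix (Fin n) (Fin n) 𝕂[X]} {a : Fin n → ℝ[X]}
    (ha0 : ∀ i, a i ≠ 0) (ha : ∀ i x, 0 ≤ (a i).eval x) (hP : IsUnit P.det)
    (hpos : IsPosSemidef (P * Matrix.diagonal fun i => (a i).map (algebraMap ℝ 𝕂)))
    (x l : ℝ) (hl : l ≤ 0) : (evalMatrix x P).charpoly.eval (l : 𝕂) ≠ 0 := by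
  have hcont : ∀ r : ℝ, Continuous fun t : ℝ => (evalMatrix t P).charpoly.eval (r : 𝕂) := by
    intro r
    simp only [Matrix.eval_charpoly]
    exact (continuous_const.sub (continuous_evalMatrix P)).matrix_det
  have hprod : ∏ i, a i ≠ 0 := Finset.prod_ne_zero_iff.2 fun i _ => ha0 i
  have hle : x ∈ {t : ℝ | ‖(evalMatrix t P).charpoly.eval ((0 : ℝ) : 𝕂)‖ ≤
      ‖(evalMatrix t P).charpoly.eval (l : 𝕂)‖} := by
    refine forall_mem_of_isClosed (𝕂 := ℝ) hprod
      (isClosed_le (hcont 0).norm (hcont l).norm) (fun t ht => ?_) x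
    have hat : ∀ i, 0 < (a i).eval t := fun i => by
      refine lt_of_le_of_ne (ha i t) (Ne.symm fun h => ht ?_)
      rw [RCLike.ofReal_real_eq_id, id, eval_prod]
      exact Finset.prod_eq_zero (Finset.mem_univ i) h
    -- `S` is the square root of `D(t)`, where `D = diagonal a`
    set r : Fin n → 𝕂 := fun i => ((Real.sqrt ((a i).eval t) : ℝ) : 𝕂) with hr
    have hr0 : ∀ i, r i ≠ 0 := fun i => by
      simpa [hr] using (Real.sqrt_pos.2 (hat i)).ne'
    set S := Matrix.diagonal r with hS
    set S' := Matrix.diagonal fun i => (r i)⁻¹ with hS'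
    have hSS' : S * S' = 1 := by
      rw [hS, hS', Matrix.diagonal_mul_diagonal, ← Matrix.diagonal_one]
      exact congrArg _ (funext fun i => mul_inv_cancel₀ (hr0 i))
    have hS'h : S'ᴴ = S' := by
      rw [hS', Matrix.diagonal_conjTranspose]
      refine congrArg _ (funext fun i => ?_)
      simp only [Pi.star_apply, hr, star_inv₀]
      exact congrArg _ (RCLike.conj_ofReal _)
    have hD : evalMatrix t (Matrix.diagonal fun i => (a i).map (algebraMap ℝ 𝕂)) = S * S := by
      rw [hS, Matrix.diagonal_mul_diagonal]
      refine Matrix.ext fun i j => ?_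
      rw [evalMatrix_apply]
      by_cases hij : i = j
      · subst hij
        rw [Matrix.diagonal_apply_eq, Matrix.diagonal_apply_eq, eval_map_ofReal, hr,
          ← RCLike.ofReal_mul, Real.mul_self_sqrt (ha i t)]
      · rw [Matrix.diagonal_apply_ne _ hij, Matrix.diagonal_apply_ne _ hij, eval_zero]
    have hH : (S' * (evalMatrix t P * S)).PosSemidef := by
      have h1 := (isPosSemidef_iff.1 hpos t).conjTranspose_mul_mul_same S'
      rw [map_mul, hD, hS'h] at h1
      have h2 : S' * (evalMatrix t P * (S * S)) * S' = S' * (evalMatrix t P * S) := by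
        calc _ = S' * (evalMatrix t P * S) * (S * S') := by simp only [Matrix.mul_assoc]
          _ = _ := by rw [hSS', Matrix.mul_one]
      rwa [h2] at h1
    have hchar : (evalMatrix t P).charpoly = ∏ i, (X - C ((hH.1.eigenvalues i : ℝ) : 𝕂)) := by
      rw [← hH.1.charpoly_eq, Matrix.charpoly_mul_comm, Matrix.mul_assoc, hSS', Matrix.mul_one]
    have heval : ∀ b : ℝ, ‖(evalMatrix t P).charpoly.eval (b : 𝕂)‖ =
        ∏ i, |b - hH.1.eigenvalues i| := by
      intro b
      rw [hchar, eval_prod, norm_prod]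
      refine Finset.prod_congr rfl fun i _ => ?_
      rw [eval_sub, eval_X, eval_C, ← RCLike.ofReal_sub, RCLike.norm_ofReal]
    change ‖_‖ ≤ ‖_‖
    rw [heval, heval]
    refine Finset.prod_le_prod (fun i _ => abs_nonneg _) fun i _ => ?_
    have h0 := hH.eigenvalues_nonneg i
    rw [abs_of_nonpos (by linarith), abs_of_nonpos (by linarith)]
    linarith
  intro h0
  have h1 : ‖(evalMatrix x P).charpoly.eval ((0 : ℝ) : 𝕂)‖ ≤
      ‖(evalMatrix x P).charpoly.eval (l : 𝕂)‖ := hle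
  rw [h0, norm_zero, norm_le_zero_iff, RCLike.ofReal_zero, ← coeff_zero_eq_eval_zero] at h1
  have h2 : (evalMatrix x P).det = 0 := by
    rw [Matrix.det_eq_sign_charpoly_coeff, h1, mul_zero]
  rw [det_evalMatrix] at h2
  exact (hP.map (evalRingHom (x : 𝕂))).ne_zero h2

end MatrixRoot

/-! ### Comparison of a matrix with its Smith normal form -/

section Compare

variable {𝕂 : Type*} [RCLike 𝕂] {n : ℕ}

/-- The monic elementary divisors of a Hermitian matrix are fixed by the involution. -/
theorem star_eq_of_smith {M S T : Matrix (Fin n) (Fin n) 𝕂[X]} {a : Fin n → 𝕂[X]}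
    (hM : M.IsHermitian) (hchain : ∀ i j, i ≤ j → a i ∣ a j) (hmon : ∀ i, (a i).Monic)
    (hS : IsUnit S.det) (hT : IsUnit T.det) (h : S * M * T = Matrix.diagonal a) (k : Fin n) :
    star (a k) = a k := by
  have hmap : ∀ p : 𝕂[X], star p = p.map (starRingEnd 𝕂) := fun _ => rfl
  have hstar : Tᴴ * M * Sᴴ = Matrix.diagonal fun i => star (a i) := by
    have h1 := congrArg Matrix.conjTranspose h
    rw [Matrix.conjTranspose_mul, Matrix.conjTranspose_mul, hM.eq,
      Matrix.diagonal_conjTranspose] at h1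
    rw [Matrix.mul_assoc, h1]
    rfl
  have hT' : IsUnit Tᴴ.det := by rw [Matrix.det_conjTranspose]; exact hT.star
  have h1 : Matrix.diagonal a * (T⁻¹ * Sᴴ) =
      (S * (Tᴴ)⁻¹) * Matrix.diagonal fun i => star (a i) := by
    calc Matrix.diagonal a * (T⁻¹ * Sᴴ) = S * M * (T * T⁻¹) * Sᴴ := by
          rw [← h]; simp only [Matrix.mul_assoc]
      _ = S * ((Tᴴ)⁻¹ * Tᴴ) * M * Sᴴ := by
          rw [Matrix.mul_nonsing_inv _ hT, Matrix.nonsing_inv_mul _ hT', Matrix.mul_one,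
            Matrix.mul_one]
      _ = _ := by rw [← hstar]; simp only [Matrix.mul_assoc]
  have hmon' : ∀ i, (star (a i)).Monic := fun i => by rw [hmap]; exact (hmon i).map _
  have hdvd : a k ∣ star (a k) := by
    refine diagonal_dvd_of_equiv hchain (fun i j hij => ?_) (fun i => (hmon' i).ne_zero) ?_ h1 k
    · rw [hmap, hmap]; exact Polynomial.map_dvd _ (hchain i j hij)
    · rw [Matrix.det_mul]
      exact hS.mul ((Matrix.isUnit_nonsing_inv_det_iff).2 hT')
  refine (eq_of_monic_of_dvd_of_natDegree_le (hmon k) (hmon' k) hdvd ?_)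
  rw [hmap, natDegree_map]

/-- If `P` is self-adjoint for the form `D`, its characteristic polynomial is real. -/
theorem star_coeff_charpoly {P D : Matrix (Fin n) (Fin n) 𝕂[X]} (hD : D.det ≠ 0)
    (h : P * D = D * Pᴴ) (i : ℕ) : star (P.charpoly.coeff i) = P.charpoly.coeff i := by
  have h1 : P.charmatrix * D.map C = D.map C * Pᴴ.charmatrix := by
    have hC : (C : 𝕂[X] →+* 𝕂[X][X]).mapMatrix P * D.map C =
        D.map C * (C : 𝕂[X] →+* 𝕂[X][X]).mapMatrix Pᴴ := by
      rw [RingHom.mapMatrix_apply, RingHom.mapMatrix_apply, ← Matrix.map_mul, h, Matrix.map_mul]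
    have hX : Matrix.scalar (Fin n) (X : 𝕂[X][X]) * D.map C =
        D.map C * Matrix.scalar (Fin n) (X : 𝕂[X][X]) :=
      (Matrix.scalar_commute (X : 𝕂[X][X]) (fun _ => Commute.all _ _) (D.map C)).eq
    rw [Matrix.charmatrix, Matrix.charmatrix, Matrix.sub_mul, Matrix.mul_sub, hC, hX]
  have hDC : (D.map C).det ≠ 0 := by
    have : (D.map C).det = C D.det := ((C : 𝕂[X] →+* 𝕂[X][X]).map_det D).symm
    rw [this]
    exact C_ne_zero.2 hD
  have h2 : P.charpoly = Pᴴ.charpoly := by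
    have h3 := congrArg Matrix.det h1
    rw [Matrix.det_mul, Matrix.det_mul, mul_comm] at h3
    rw [Matrix.charpoly, Matrix.charpoly]
    exact mul_left_cancel₀ hDC h3
  have h3 : Pᴴ.charpoly = P.charpoly.map (starRingEnd 𝕂[X]) := by
    rw [← Matrix.charpoly_transpose P, ← Matrix.charpoly_map]
    rfl
  have h4 := congrArg (fun p => coeff p i) h3
  simp only [← h2, coeff_map] at h4
  exact h4.symm

/-- Suppose `P` and `X` are self-adjoint for the form `D`, commute, and `X ^ 2 = P + det D • E`.
Then `X` is invertible modulo `det D` and transforms the form of `P * D`, which is congruent to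
`X * D * Xᴴ` modulo `det D`, into the form of `D`; so both have the same self-dual lattices. -/
theorem nonempty_selfDual_equiv {P D X E : Matrix (Fin n) (Fin n) 𝕂[X]} (hP : IsUnit P.det)
    (hD : D.det ≠ 0) (hDH : D.IsHermitian) (hM : (P * D).IsHermitian)
    (hXD : X * D = D * Xᴴ) (hXP : Commute X P) (hX : X ^ 2 = P + D.det • E) :
    Nonempty ({L : Submodule 𝕂[X] (Fin n → 𝕂[X]) //
        IsSelfDual (P * D).adjugate (P * D).det L} ≃
      {L : Submodule 𝕂[X] (Fin n → 𝕂[X]) // IsSelfDual D.adjugate D.det L}) := by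
  have hstar : ∀ {N : Matrix (Fin n) (Fin n) 𝕂[X]}, N.IsHermitian → star N.det = N.det :=
    fun hN => by rw [← Matrix.det_conjTranspose, hN.eq]
  have hdet : (P * D).det = P.det * D.det := Matrix.det_mul _ _
  have hassoc : Associated (P * D).det D.det := by
    rw [hdet]
    exact associated_unit_mul_left _ _ hP
  obtain ⟨u, hu⟩ := hassoc.dvd
  have hPP : P * P⁻¹ = 1 := Matrix.mul_nonsing_inv _ hP
  have hPP' : P⁻¹ * P = 1 := Matrix.nonsing_inv_mul _ hP
  have hXP' : X * P⁻¹ = P⁻¹ * X := by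
    calc X * P⁻¹ = P⁻¹ * P * X * P⁻¹ := by rw [hPP', Matrix.one_mul]
      _ = P⁻¹ * (X * P) * P⁻¹ := by rw [hXP.eq]; simp only [Matrix.mul_assoc]
      _ = P⁻¹ * X * (P * P⁻¹) := by simp only [Matrix.mul_assoc]
      _ = P⁻¹ * X := by rw [hPP, Matrix.mul_one]
  have hadjP : P.adjugate = P.det • P⁻¹ := by
    calc P.adjugate = P.adjugate * (P * P⁻¹) := by rw [hPP, Matrix.mul_one]
      _ = P.det • P⁻¹ := by
        rw [← Matrix.mul_assoc, Matrix.adjugate_mul, Matrix.smul_mul, Matrix.one_mul]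
  have hXadj : Xᴴ * D.adjugate = D.adjugate * X := by
    apply (isRegular_of_det_ne_zero hD).left
    change D * (Xᴴ * D.adjugate) = D * (D.adjugate * X)
    rw [← Matrix.mul_assoc, ← hXD, Matrix.mul_assoc, Matrix.mul_adjugate, ← Matrix.mul_assoc,
      Matrix.mul_adjugate, Matrix.smul_mul, Matrix.one_mul, Matrix.mul_smul, Matrix.mul_one]
  have hform : Xᴴ * (P * D).adjugate * X =
      P.det • (D.adjugate + D.det • (D.adjugate * P⁻¹ * E)) := by
    calc Xᴴ * (P * D).adjugate * X
        = P.det • (Xᴴ * D.adjugate * P⁻¹ * X) := by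
          rw [Matrix.adjugate_mul_distrib, hadjP]
          simp only [Matrix.mul_smul, Matrix.smul_mul, Matrix.mul_assoc]
      _ = P.det • (D.adjugate * (X * P⁻¹) * X) := by
          rw [hXadj]; simp only [Matrix.mul_assoc]
      _ = P.det • (D.adjugate * P⁻¹ * X ^ 2) := by
          rw [hXP', pow_two]; simp only [Matrix.mul_assoc]
      _ = _ := by
          rw [hX, Matrix.mul_add, Matrix.mul_assoc _ P⁻¹ P, hPP', Matrix.mul_one, Matrix.mul_smul]
  have hXX : X * (X * P⁻¹) = 1 + D.det • (E * P⁻¹) := by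
    rw [← Matrix.mul_assoc, ← pow_two, hX, Matrix.add_mul, hPP, Matrix.smul_mul]
  -- `X` and `X * P⁻¹` are mutually inverse modulo `det D`
  have hinv : ∀ {B C : Matrix (Fin n) (Fin n) 𝕂[X]}, B * C = 1 + D.det • (E * P⁻¹) →
      ∀ v, ∃ w, B *ᵥ (C *ᵥ v) = v + (P * D).det • w := by
    intro B C hBC v
    refine ⟨u • ((E * P⁻¹) *ᵥ v), ?_⟩
    rw [Matrix.mulVec_mulVec, hBC, Matrix.add_mulVec, Matrix.one_mulVec, Matrix.smul_mulVec,
      smul_smul, ← hu]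
  refine ⟨selfDualEquiv (hstar hM) (hstar hDH) hassoc (A := X) (B := X * P⁻¹)
    (hinv hXX) (hinv ?_) fun v w => ?_⟩
  · rw [← hXX, Matrix.mul_assoc, hXP']
  · have h1 : star (X *ᵥ v) ⬝ᵥ (P * D).adjugate *ᵥ (X *ᵥ w) =
        P.det * (star v ⬝ᵥ D.adjugate *ᵥ w +
          D.det * (star v ⬝ᵥ (D.adjugate * P⁻¹ * E) *ᵥ w)) := by
      rw [Matrix.star_mulVec, ← Matrix.dotProduct_mulVec, Matrix.mulVec_mulVec,
        Matrix.mulVec_mulVec, hform, Matrix.smul_mulVec, Matrix.add_mulVec, Matrix.smul_mulVec,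
        dotProduct_smul, dotProduct_add, dotProduct_smul, smul_eq_mul, smul_eq_mul]
    rw [h1, hdet, mul_dvd_mul_iff_left hP.ne_zero, dvd_add_left (dvd_mul_right _ _)]

end Compare

end HermitianFactorization

theorem mainTheorem5 {𝕂 : Type*} [RCLike 𝕂] (n : ℕ)
    (M D : Matrix (Fin n) (Fin n) 𝕂[X])
    (hM : M.IsHermitian) (hpos : HermitianFactorization.IsPosSemidef M) (hdet : M.det ≠ 0)
    (hD : HermitianFactorization.IsMonicSmithNormalForm M D) :
    Nonempty (HermitianFactorization.Fac M n ≃ HermitianFactorization.Fac D n) := by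
  open HermitianFactorization in
  obtain ⟨a, rfl, hchain, hmon, S, T, hS, hT, hSMT⟩ := hD
  rw [Matrix.isUnit_iff_isUnit_det] at hS hT
  have hDdet : (Matrix.diagonal a).det ≠ 0 := by
    rw [← hSMT, Matrix.det_mul, Matrix.det_mul]
    exact mul_ne_zero (mul_ne_zero hS.ne_zero hdet) hT.ne_zero
  have ha0 : ∀ i, a i ≠ 0 := fun i h0 => hDdet (by
    rw [Matrix.det_diagonal]; exact Finset.prod_eq_zero (Finset.mem_univ i) h0)
  -- the elementary divisors are the images of real polynomials `b i`
  choose b hb using fun i => exists_real_of_star_eq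
    (star_eq_of_smith hM hchain (fun i => hmon i (ha0 i)) hS hT hSMT i)
  obtain rfl : (fun i => (b i).map (algebraMap ℝ 𝕂)) = a := funext hb
  clear hb
  have hbmon : ∀ i, (b i).Monic := fun i => (monic_map_iff (f := algebraMap ℝ 𝕂)).1 (hmon i (ha0 i))
  have hb0 : ∀ i, b i ≠ 0 := fun i => (hbmon i).ne_zero
  have hbchain : ∀ i j, i ≤ j → b i ∣ b j := fun i j hij =>
    (map_dvd_map' (algebraMap ℝ 𝕂)).1 (hchain i j hij)
  set D := Matrix.diagonal fun i => (b i).map (algebraMap ℝ 𝕂) with hDdef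
  -- up to congruence, `M` is the product of an invertible matrix `P` and `D`
  set P := Tᴴ * S⁻¹ with hPdef
  have hP : IsUnit P.det := by
    rw [hPdef, Matrix.det_mul, Matrix.det_conjTranspose]
    exact hT.star.mul (Matrix.isUnit_nonsing_inv_det_iff.2 hS)
  have hPD : Tᴴ * M * T = P * D := by
    calc Tᴴ * M * T = Tᴴ * ((S⁻¹ * S) * M) * T := by
          rw [Matrix.nonsing_inv_mul _ hS, Matrix.one_mul]
      _ = P * D := by rw [← hSMT, hPdef]; simp only [Matrix.mul_assoc]
  have hPDherm : (P * D).IsHermitian := hPD ▸ Matrix.isHermitian_conjTranspose_mul_mul T hM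
  have hPDpos : IsPosSemidef (P * D) := hPD ▸ hpos.conjTranspose_mul_mul_same T
  have hDherm : D.IsHermitian := by
    rw [hDdef, Matrix.IsHermitian, Matrix.diagonal_conjTranspose]
    exact congrArg _ (funext fun i => star_map_ofReal (b i))
  have hcomm : P * D = D * Pᴴ := by
    rw [← hPDherm.eq, Matrix.conjTranspose_mul, hDherm.eq]
  have hbnonneg : ∀ i x, 0 ≤ (b i).eval x := fun i =>
    eval_nonneg_of_even_rootMultiplicity (b i) (hbmon i)
      (even_rootMultiplicity_of_isPosSemidef hb0 hbchain hP hPDherm hPDpos i)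
  have hDpos : IsPosSemidef D := by
    intro x
    have h1 : evalMatrix x D = Matrix.diagonal fun i => (((b i).eval x : ℝ) : 𝕂) := by
      refine Matrix.ext fun i j => ?_
      rw [evalMatrix_apply, hDdef, Matrix.diagonal_apply, Matrix.diagonal_apply]
      split_ifs
      · exact eval_map_ofReal _ _
      · exact eval_zero
    change (evalMatrix x D).PosSemidef
    rw [h1, Matrix.posSemidef_diagonal_iff]
    exact fun i => RCLike.ofReal_nonneg.2 (hbnonneg i x)
  have hDdet' : D.det = (∏ i, b i).map (algebraMap ℝ 𝕂) := by
    rw [hDdef, Matrix.det_diagonal, Polynomial.map_prod]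
  obtain ⟨s, e, hse⟩ := exists_sq_eq_add_smul hP (star_coeff_charpoly hDdet hcomm)
    (eval_charpoly_ne_zero hb0 hbnonneg hP hPDpos)
    (Finset.prod_ne_zero_iff.2 fun i _ => hb0 i)
  rw [← hDdet'] at hse
  have hXP : Commute (realAeval P s) P := by
    have := commute_realAeval P s X
    rwa [realAeval_X] at this
  obtain ⟨f⟩ := nonempty_selfDual_equiv hP hDdet hDherm hPDherm
    (realAeval_mul_eq hcomm s) hXP hse
  have hPDdet : (P * D).det ≠ 0 := by
    rw [Matrix.det_mul]; exact mul_ne_zero hP.ne_zero hDdet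
  have g : Fac M n ≃ Fac (P * D) n :=
    hPD ▸ facCongr (M := M) T T⁻¹ (Matrix.mul_nonsing_inv T hT)
  exact ⟨g.trans ((facEquivSelfDual hPDherm hPDpos hPDdet).trans
    (f.trans (facEquivSelfDual hDherm hDpos hDdet).symm))⟩
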